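/- Let $d\in\mathbb N$, let $\gamma\in L^1(\mathbb R^+;\mathbb R^{d\times d})$, and let $\Sigma\in\mathbb R^{d\times d}$ be symmetric positive semidefinite. Let $V_0\sim\mathcal N(0,\Sigma)$, and let $F=(F(t))_{t\ge 0}$ be an $\mathbb R^d$-valued measurable, mean-square continuous, stationary Gaussian process which is independent of $V_0$. Here a process $X$ is called stationary if it is centered and square integrable and if $\mathbb E\bigl(X(s+t)X(s)^*\bigr)$ does not depend on $s\ge 0$ for every $t\ge 0$; then $C_X(t)=\mathbb E\bigl(X(s+t)X(s)^*\bigr)$, $t\ge0$, denotes its autocorrelation function. Let $V$ be the strong solution of Kubo's generalized Langevin equation $$\dot V(t)=-\int_0^t\gamma(t-s)V(s)\,ds+F(t),\quad t>0,\qquad V(0)=V_0,$$ i.e. a measurable process with almost surely locally integrable paths such that, for every $t\ge 0$, almost surely $$V(t)=V_0-\int_0^t\int_0^\tau\gamma(\tau-s)V(s)\,ds\,d\tau+\int_0^tF(\tau)\,d\tau .$$ Then $V$ is stationary if and only if $$C_F(t)=\gamma(t)\Sigma\qquad\text{for almost every } t\ge 0 .$$ In this case $$C_V(t)=r(t)\Sigma\qquad\text{for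 every } t\ge 0,$$ where $r$ is the differential resolvent of $\gamma$, i.e. the $\mathbb R^{d\times d}$-valued solution of $r'(t)=-\int_0^t\gamma(t-s)r(s)\,ds$ for $t\ge 0$, $r(0)=I$. -/

import Mathlib

open MeasureTheory ProbabilityTheory Set Filter Topology

namespace KuboGLE

variable {Ω : Type*} [MeasurableSpace Ω] {d : ℕ}

/-- The matrix `𝔼 (X Y^*)` of two `ℝ^d`-valued random vectors. -/
noncomputable def crossMoment (P : Measure Ω) (X Y : Ω → EuclideanSpace ℝ (Fin d)) :
    Matrix (Fin d) (Fin d) ℝ :=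
  Matrix.of fun i j => ∫ ω, X ω i * Y ω j ∂P

/-- A process `(X t)_{t ≥ 0}` is (second order) stationary and centered: every `X t` is square
integrable with mean zero, and `𝔼 (X (s + t) X(s)^*)` does not depend on `s ≥ 0`. Only the times
`t ≥ 0` matter. -/
structure IsStationary (P : Measure Ω) (X : ℝ → Ω → EuclideanSpace ℝ (Fin d)) : Prop where
  memLp : ∀ t, 0 ≤ t → MemLp (X t) 2 P
  centered : ∀ t, 0 ≤ t → ∫ ω, X t ω ∂P = 0
  shift : ∀ s t, 0 ≤ s → 0 ≤ t →
    crossMoment P (X (s + t)) (X s) = crossMoment P (X t) (X 0)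

/-- The autocorrelation function `C_X(t) = 𝔼 (X (s + t) X(s)^*)`, `t ≥ 0`, of a stationary
process; by stationarity it may be evaluated at `s = 0`. -/
noncomputable def autoCorr (P : Measure Ω) (X : ℝ → Ω → EuclideanSpace ℝ (Fin d)) (t : ℝ) :
    Matrix (Fin d) (Fin d) ℝ :=
  crossMoment P (X t) (X 0)

/-- Mean-square continuity of `(X t)_{t ≥ 0}`. -/
def IsMeanSquareContinuous (P : Measure Ω) (X : ℝ → Ω → EuclideanSpace ℝ (Fin d)) : Prop :=
  ∀ t, 0 ≤ t → Tendsto (fun u => eLpNorm (X u - X t) 2 P) (𝓝[Ici 0] t) (𝓝 0)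

/-- `(t, ω) ↦ X t ω` is jointly measurable on `[0, ∞) × Ω`, up to a null set of the product
measure. This is what makes pathwise time integrals meaningful. -/
def IsMeasurableProcess (P : Measure Ω) (X : ℝ → Ω → EuclideanSpace ℝ (Fin d)) : Prop :=
  AEStronglyMeasurable (fun p : ℝ × Ω => X p.1 p.2) ((volume.restrict (Ici 0)).prod P)

/-- `V` is a strong solution of the generalized Langevin equation
`dV/dt (t) = - ∫_0^t γ(t-s) V(s) ds + F(t)`, `V(0) = V₀`: it is a measurable process with almost
surely locally integrable paths, and for every `t ≥ 0` it satisfies almost surely the integrated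
equation. -/
structure IsStrongSolution (P : Measure Ω) (γ : ℝ → Matrix (Fin d) (Fin d) ℝ)
    (V₀ : Ω → EuclideanSpace ℝ (Fin d)) (F V : ℝ → Ω → EuclideanSpace ℝ (Fin d)) : Prop where
  measurable : IsMeasurableProcess P V
  integrable : ∀ᵐ ω ∂P, ∀ T, IntegrableOn (fun t => V t ω) (Icc 0 T)
  integrated : ∀ t, 0 ≤ t → ∀ᵐ ω ∂P,
    V t ω = V₀ ω
      - (∫ τ in (0 : ℝ)..t, ∫ s in (0 : ℝ)..τ,
          Matrix.toEuclideanCLM (𝕜 := ℝ) (γ (τ - s)) (V s ω))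
      + ∫ τ in (0 : ℝ)..t, F τ ω

/-- `r` is the differential resolvent of the kernel `γ`:
`r'(t) = - ∫_0^t γ(t-s) r(s) ds` for `t ≥ 0`, and `r(0) = I` (all entrywise; at `t = 0` the
derivative is the right-hand one). -/
structure IsDifferentialResolvent (γ r : ℝ → Matrix (Fin d) (Fin d) ℝ) : Prop where
  init : r 0 = 1
  deriv : ∀ t, 0 ≤ t → ∀ i j,
    HasDerivWithinAt (fun u => r u i j)
      (- ∫ s in (0 : ℝ)..t, (γ (t - s) * r s) i j) (Ici 0) t

end KuboGLE

set_option linter.unusedSectionVars false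
set_option linter.unusedVariables false

/-! Let `Γ` be the primitive of `γ`, zero on negative times. Fubini turns the integrated Langevin
equation into a Volterra equation `V + Γ * V = Y` with bounded continuous kernel and `Y(t) = V₀ +
∫₀ᵗ F`. Everything then concerns second moments `𝔼 (X Y^*)`, taken as operators so that the argument
runs in a complete normed star algebra.

Put `C(t) = 𝔼 (V(t) V₀^*)`. Since `F` is uncorrelated with `V₀`, `C + Γ * C = Σ` holds whether or
not `V` is stationary (`secondMoment_init`). Extend `C` by `C(-x) = C(x)^*`. Applying the Volterra
operator in both variables to `C(t - s)` gives, for `0 ≤ s ≤ t`, `Σ + ∫₀ˢ (Γ(t-u) Σ + Σ Γ(u)^*) du`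
(`biVolterra_eq_of_le`): `C` has dropped out. With `G` the primitive of `C_F`, stationarity of `F`
gives `𝔼 (Y(t) Y(s)^*) = Σ + ∫₀ˢ (G(t-u) + G(u)^*) du` (`secondMoment_rhs`).

If `V` is stationary, the two expressions agree. Then `D = G - Γ Σ` satisfies `∫₀ˢ (D(t-u) + D(u)^*)
du = 0`, and differentiating at `s = 0` gives `D = 0`. Conversely, if `G = Γ Σ`, then `𝔼 (V(t)
V(s)^*)` and `C(t - s)` have the same image under the two-variable Volterra operator, so they
coincide by `volterra_unique`, used once per variable. Lebesgue differentiation passes between `G =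
Γ Σ` and the almost everywhere identity. The formula for `C_V` is uniqueness again: `r Σ` solves the
equation of `C`.

A strong solution has only locally integrable paths, so its square integrability must be proved
first (`memLp_two_of_volterra`): truncate on an event independent of time, apply Gronwall uniformly
in the truncation, and pass to the limit with Fatou. -/

namespace KuboGLE

/-! ### Gronwall, uniqueness and Fubini for linear Volterra equations -/

section Volterra

/-- A Gronwall-type bound for integrable functions. -/
lemma gronwall_of_integrable {f : ℝ → ℝ} {T a b : ℝ} (hb : 0 < b) (ha : 0 ≤ a)
    (hf : IntegrableOn f (Icc 0 T)) (hf0 : ∀ t ∈ Icc 0 T, 0 ≤ f t)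
    (h : ∀ t ∈ Icc 0 T, f t ≤ a + b * ∫ s in (0 : ℝ)..t, f s) :
    ∀ t ∈ Icc 0 T, f t ≤ 2 * a * Real.exp (2 * b * t) := by
  have hii : ∀ t ∈ Icc 0 T, IntervalIntegrable f volume 0 t := fun t ht => by
    rw [intervalIntegrable_iff_integrableOn_Icc_of_le ht.1]
    exact hf.mono_set (Icc_subset_Icc_right ht.2)
  set M : ℝ := a + b * ∫ s in Icc 0 T, f s with hM
  have hI0 : 0 ≤ ∫ s in Icc 0 T, f s := setIntegral_nonneg measurableSet_Icc hf0
  have hM0 : 0 ≤ M := by positivity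
  -- `f` is merely integrable, so the inequality is iterated from the crude bound `M`. With rate `2
  -- * b`, integrating the exponential yields a factor `1 / (2 * b)`, so each pass halves the excess
  -- `M / 2 ^ n`.
  have hbound : ∀ n : ℕ, ∀ t ∈ Icc 0 T,
      f t ≤ (2 * a + M / 2 ^ n) * Real.exp (2 * b * t) := by
    intro n
    induction n with
    | zero =>
      intro t ht
      have h1 : f t ≤ M := by
        refine (h t ht).trans ?_
        rw [hM]
        gcongr
        rw [intervalIntegral.integral_of_le ht.1]
        exact setIntegral_mono_set hf (ae_restrict_of_forall_mem measurableSet_Icc hf0)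
          (Eventually.of_forall fun x hx => ⟨hx.1.le, hx.2.trans ht.2⟩)
      have h2 : 1 ≤ Real.exp (2 * b * t) :=
        Real.one_le_exp (by have := ht.1; positivity)
      simp only [pow_zero, div_one]
      nlinarith
    | succ n ih =>
      intro t ht
      have h1 : ∫ s in (0 : ℝ)..t, f s
          ≤ ∫ s in (0 : ℝ)..t, (2 * a + M / 2 ^ n) * Real.exp (2 * b * s) := by
        refine intervalIntegral.integral_mono_on ht.1 (hii t ht)
          (by apply Continuous.intervalIntegrable; fun_prop) fun s hs => ?_
        exact ih s ⟨hs.1, hs.2.trans ht.2⟩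
      have h2 : ∫ s in (0 : ℝ)..t, (2 * a + M / 2 ^ n) * Real.exp (2 * b * s)
          = (2 * a + M / 2 ^ n) * ((Real.exp (2 * b * t) - 1) / (2 * b)) := by
        rw [intervalIntegral.integral_const_mul,
          intervalIntegral.integral_comp_mul_left (fun x => Real.exp x) (by positivity)]
        simp only [smul_eq_mul, integral_exp, mul_zero, Real.exp_zero]
        field_simp
      rw [h2] at h1
      have h3 := (h t ht).trans (add_le_add_right (mul_le_mul_of_nonneg_left h1 hb.le) a)
      have h4 : a + b * ((2 * a + M / 2 ^ n) * ((Real.exp (2 * b * t) - 1) / (2 * b)))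
          = a + (a + M / 2 ^ (n + 1)) * (Real.exp (2 * b * t) - 1) := by
        field_simp
        ring
      rw [h4] at h3
      have h5 : 1 ≤ Real.exp (2 * b * t) :=
        Real.one_le_exp (by have := ht.1; positivity)
      have h6 : 0 ≤ M / 2 ^ (n + 1) := by positivity
      nlinarith
  intro t ht
  have hlim : Tendsto (fun n : ℕ => (2 * a + M / 2 ^ n) * Real.exp (2 * b * t)) atTop
      (𝓝 ((2 * a + 0) * Real.exp (2 * b * t))) := by
    refine Tendsto.mul_const _ (tendsto_const_nhds.add ?_)
    exact tendsto_const_nhds.div_atTop (tendsto_pow_atTop_atTop_of_one_lt (by norm_num))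
  rw [add_zero] at hlim
  exact ge_of_tendsto' hlim fun n => hbound n t ht

variable {G : Type*} [NormedAddCommGroup G]

lemma eq_zero_of_norm_le_integral {q : ℝ → G} {T g : ℝ} (hg : 0 ≤ g)
    (hq : IntegrableOn q (Icc 0 T))
    (h : ∀ t ∈ Icc 0 T, ‖q t‖ ≤ g * ∫ s in (0 : ℝ)..t, ‖q s‖) :
    ∀ t ∈ Icc 0 T, q t = 0 := by
  intro t ht
  -- `g` may vanish while the Gronwall rate must be positive, hence `g + 1`.
  have := gronwall_of_integrable (f := fun t => ‖q t‖) (a := 0) (b := g + 1) (T := T)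
    (by positivity) le_rfl hq.norm (fun _ _ => norm_nonneg _) (fun s hs => ?_) t ht
  · simpa using this
  · refine (h s hs).trans ?_
    rw [zero_add]
    gcongr
    · exact intervalIntegral.integral_nonneg hs.1 fun _ _ => norm_nonneg _
    · linarith

/-- Uniqueness for linear Volterra equations with bounded kernel. -/
lemma volterra_unique {A : Type*} [NormedRing A] [NormedAlgebra ℝ A]
    {Γ : ℝ → A} {g : ℝ} (hΓ : Continuous Γ) (hg : ∀ x, ‖Γ x‖ ≤ g)
    {p q : ℝ → A} {T : ℝ} (hp : IntegrableOn p (Icc 0 T)) (hq : IntegrableOn q (Icc 0 T))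
    (h : ∀ t ∈ Icc 0 T, p t + ∫ u in (0 : ℝ)..t, Γ (t - u) * p u
      = q t + ∫ u in (0 : ℝ)..t, Γ (t - u) * q u) :
    ∀ t ∈ Icc 0 T, p t = q t := by
  have hg0 : 0 ≤ g := (norm_nonneg _).trans (hg 0)
  have hii : ∀ f : ℝ → A, IntegrableOn f (Icc 0 T) → ∀ t ∈ Icc 0 T,
      IntervalIntegrable (fun u => Γ (t - u) * f u) volume 0 t := fun f hf t ht => by
    have h1 : IntervalIntegrable f volume 0 t := by
      rw [intervalIntegrable_iff_integrableOn_Icc_of_le ht.1]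
      exact hf.mono_set (Icc_subset_Icc_right ht.2)
    exact h1.continuousOn_mul (by fun_prop)
  have key := eq_zero_of_norm_le_integral (q := fun t => p t - q t) hg0 (hp.sub hq) ?_
  · exact fun t ht => sub_eq_zero.1 (key t ht)
  intro t ht
  have h1 : p t - q t = - ∫ u in (0 : ℝ)..t, Γ (t - u) * (p u - q u) := by
    simp_rw [mul_sub]
    rw [intervalIntegral.integral_sub (hii p hp t ht) (hii q hq t ht)]
    have := h t ht
    rw [neg_sub]
    rw [← sub_eq_zero] at this ⊢
    rw [← this]
    abel
  have h2 : IntervalIntegrable (fun u => ‖p u - q u‖) volume 0 t := by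
    rw [intervalIntegrable_iff_integrableOn_Icc_of_le ht.1]
    exact ((hp.sub hq).mono_set (Icc_subset_Icc_right ht.2)).norm
  rw [h1, norm_neg, ← intervalIntegral.integral_const_mul]
  refine intervalIntegral.norm_integral_le_of_norm_le ht.1 ?_ (h2.const_mul g)
  exact Eventually.of_forall fun u _ => (norm_mul_le _ _).trans (by gcongr; exact hg _)

variable [NormedSpace ℝ G]

/-- Fubini's theorem on a triangle. -/
lemma integral_triangle_swap {f : ℝ → ℝ → G} {t : ℝ} (ht : 0 ≤ t)
    (hf : Integrable (fun p : ℝ × ℝ => (Iio p.2).indicator (fun u => f u p.2) p.1)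
      ((volume.restrict (Ioc 0 t)).prod (volume.restrict (Ioc 0 t)))) :
    ∫ σ in (0 : ℝ)..t, ∫ u in (0 : ℝ)..σ, f u σ = ∫ u in (0 : ℝ)..t, ∫ σ in u..t, f u σ := by
  have h := integral_integral_swap (f := fun u σ => (Iio σ).indicator (fun u => f u σ) u) hf
  rw [intervalIntegral.integral_of_le ht, intervalIntegral.integral_of_le ht]
  refine Eq.trans ?_ (h.symm.trans ?_)
  · refine setIntegral_congr_fun measurableSet_Ioc fun σ hσ => ?_
    rw [intervalIntegral.integral_of_le hσ.1.le, setIntegral_indicator measurableSet_Iio,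
      integral_Ioc_eq_integral_Ioo]
    congr 2
    ext u
    simp only [mem_Ioo, mem_inter_iff, mem_Ioc, mem_Iio]
    have := hσ.2
    grind
  · refine setIntegral_congr_fun measurableSet_Ioc fun u hu => ?_
    have : (fun σ => (Iio σ).indicator (fun u => f u σ) u) = (Ioi u).indicator (fun σ => f u σ) := by
      ext σ
      simp [indicator]
    rw [this, intervalIntegral.integral_of_le hu.2, setIntegral_indicator measurableSet_Ioi]
    congr 2
    ext σ
    simp only [mem_inter_iff, mem_Ioc, mem_Ioi]
    have := hu.1
    grind

lemma integral_triangle_swap_of_continuous {f : ℝ → ℝ → G} {t : ℝ} (ht : 0 ≤ t)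
    (hf : Continuous (Function.uncurry f)) :
    ∫ σ in (0 : ℝ)..t, ∫ u in (0 : ℝ)..σ, f u σ = ∫ u in (0 : ℝ)..t, ∫ σ in u..t, f u σ := by
  refine integral_triangle_swap ht ?_
  have h1 : Integrable (Function.uncurry f)
      ((volume.restrict (Ioc 0 t)).prod (volume.restrict (Ioc 0 t))) := by
    rw [Measure.prod_restrict, ← Measure.volume_eq_prod]
    exact (hf.continuousOn.integrableOn_compact (isCompact_Icc.prod isCompact_Icc)).mono_set
      (Set.prod_mono Ioc_subset_Icc_self Ioc_subset_Icc_self)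
  have h2 := h1.indicator (s := {p : ℝ × ℝ | p.1 < p.2})
    (measurableSet_lt measurable_fst measurable_snd)
  refine h2.congr (Eventually.of_forall fun p => ?_)
  simp [indicator, Function.uncurry]

variable {E₁ E₂ : Type*} [NormedAddCommGroup E₁] [NormedSpace ℝ E₁] [NormedAddCommGroup E₂]
  [NormedSpace ℝ E₂]

/-- This supplies the hypothesis of Fubini on the triangle: the integrand of a convolution of two
`L¹` functions is jointly integrable, and restricting it to the triangle keeps it so. -/
lemma integrable_triangle_convolution (L : E₁ →L[ℝ] E₂ →L[ℝ] G) {k : ℝ → E₁} {v : ℝ → E₂}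
    {t : ℝ} (hk : Integrable k) (hv : IntegrableOn v (Icc 0 t)) :
    Integrable (fun p : ℝ × ℝ => (Iio p.2).indicator (fun u => L (k (p.2 - u)) (v u)) p.1)
      ((volume.restrict (Ioc 0 t)).prod (volume.restrict (Ioc 0 t))) := by
  have hv' : Integrable v (volume.restrict (Ioc 0 t)) := hv.mono_set Ioc_subset_Icc_self
  have h1 := hv'.convolution_integrand L.flip hk
  have h2 : Integrable (fun p : ℝ × ℝ => L (k (p.1 - p.2)) (v p.2))
      ((volume.restrict (Ioc 0 t)).prod (volume.restrict (Ioc 0 t))) := by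
    have : Integrable (fun p : ℝ × ℝ => L (k (p.1 - p.2)) (v p.2))
        (volume.prod (volume.restrict (Ioc 0 t))) := h1
    exact this.mono_measure (Measure.prod_mono Measure.restrict_le_self le_rfl)
  have h3 := h2.swap.indicator (s := {p : ℝ × ℝ | p.1 < p.2})
    (measurableSet_lt measurable_fst measurable_snd)
  refine h3.congr (Eventually.of_forall fun p => ?_)
  simp [indicator]

/-- The double time integral of a convolution is a single convolution with the primitive of the
kernel. -/
lemma integral_convolution_eq [CompleteSpace G] [CompleteSpace E₁]
    (L : E₁ →L[ℝ] E₂ →L[ℝ] G) {k : ℝ → E₁} {v : ℝ → E₂}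
    {t : ℝ} (ht : 0 ≤ t) (hk : Integrable k) (hv : IntegrableOn v (Icc 0 t)) :
    ∫ τ in (0 : ℝ)..t, ∫ s in (0 : ℝ)..τ, L (k (τ - s)) (v s)
      = ∫ s in (0 : ℝ)..t, L (∫ x in (0 : ℝ)..(t - s), k x) (v s) := by
  rw [integral_triangle_swap (f := fun s τ => L (k (τ - s)) (v s)) ht
    (integrable_triangle_convolution L hk hv)]
  refine intervalIntegral.integral_congr fun s _ => ?_
  have h1 : IntervalIntegrable (fun σ => k (σ - s)) volume s t := (hk.comp_sub_right s).intervalIntegrable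
  have h2 := (L.flip (v s)).intervalIntegral_comp_comm h1
  simp only [ContinuousLinearMap.flip_apply] at h2
  rw [h2, intervalIntegral.integral_comp_sub_right (fun x => k x), sub_self]

lemma intervalIntegrable_convolution (L : E₁ →L[ℝ] E₂ →L[ℝ] G) {k : ℝ → E₁} {v : ℝ → E₂}
    {t : ℝ} (ht : 0 ≤ t) (hk : Integrable k) (hv : IntegrableOn v (Icc 0 t)) :
    IntervalIntegrable (fun τ => ∫ s in (0 : ℝ)..τ, L (k (τ - s)) (v s)) volume 0 t := by
  have h := (integrable_triangle_convolution L hk hv).integral_prod_right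
  rw [intervalIntegrable_iff_integrableOn_Ioc_of_le ht]
  refine Integrable.congr h ?_
  refine ae_restrict_of_forall_mem measurableSet_Ioc fun σ hσ => ?_
  change ∫ x in Ioc 0 t, (Iio σ).indicator (fun u => L (k (σ - u)) (v u)) x
    = ∫ s in (0 : ℝ)..σ, L (k (σ - s)) (v s)
  rw [intervalIntegral.integral_of_le hσ.1.le, setIntegral_indicator measurableSet_Iio,
    integral_Ioc_eq_integral_Ioo]
  congr 2
  ext u
  simp only [mem_Ioo, mem_inter_iff, mem_Ioc, mem_Iio]
  have := hσ.2
  grind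

/-- A convolution of a bounded continuous kernel supported in `[0, ∞)` with an integrable function
is continuous. -/
lemma continuousOn_volterra_integral {A : Type*} [NormedRing A] [NormedAlgebra ℝ A]
    {Γ : ℝ → A} {g : ℝ} (hΓ : Continuous Γ) (hg : ∀ x, ‖Γ x‖ ≤ g) (hΓ0 : ∀ x ≤ 0, Γ x = 0)
    {q : ℝ → A} (hq : ∀ T, IntegrableOn q (Icc 0 T)) :
    ContinuousOn (fun t => ∫ u in (0 : ℝ)..t, Γ (t - u) * q u) (Ici 0) := by
  have key : ∀ T, ContinuousOn (fun t => ∫ u in (0 : ℝ)..t, Γ (t - u) * q u) (Icc 0 T) := by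
    intro T
    by_cases hT : 0 ≤ T
    swap
    · simp [Icc_eq_empty hT]
    have hqT : IntervalIntegrable q volume 0 T := by
      rw [intervalIntegrable_iff_integrableOn_Icc_of_le hT]
      exact hq T
    -- Since `Γ` vanishes on nonpositive arguments, the moving upper limit `t` may be replaced by
    -- the fixed `T`; dominated convergence then applies.
    have h1 : Continuous (fun t => ∫ u in (0 : ℝ)..T, Γ (t - u) * q u) := by
      refine intervalIntegral.continuous_of_dominated_interval (bound := fun u => g * ‖q u‖)
        (fun t => ?_) (fun t => Eventually.of_forall fun u _ => ?_) (hqT.norm.const_mul g)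
        (Eventually.of_forall fun u _ => by fun_prop)
      · exact (hqT.continuousOn_mul (show ContinuousOn (fun u => Γ (t - u)) _ by fun_prop)).def'.aestronglyMeasurable
      · exact (norm_mul_le _ _).trans (by gcongr; exact hg _)
    refine h1.continuousOn.congr fun t ht => ?_
    simp only
    have h2 : ∀ a b, a ∈ Icc 0 T → b ∈ Icc 0 T → IntervalIntegrable (fun u => Γ (t - u) * q u) volume a b := by
      intro a b ha hb
      refine (hqT.continuousOn_mul (show ContinuousOn (fun u => Γ (t - u)) _ by fun_prop)).mono_set ?_
      rw [uIcc_of_le hT]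
      exact Set.uIcc_subset_Icc ha hb
    rw [← intervalIntegral.integral_add_adjacent_intervals (h2 0 t ⟨le_rfl, hT⟩ ht)
      (h2 t T ht ⟨hT, le_rfl⟩)]
    have h3 : ∫ u in t..T, Γ (t - u) * q u = 0 := by
      rw [intervalIntegral.integral_of_le ht.2]
      refine setIntegral_eq_zero_of_forall_eq_zero fun u hu => ?_
      rw [hΓ0 _ (by linarith [hu.1]), zero_mul]
    rw [h3, add_zero]
  intro t ht
  have h1 := key (t + 1) t ⟨ht, by linarith⟩
  refine h1.mono_of_mem_nhdsWithin ?_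
  rw [mem_nhdsWithin]
  exact ⟨Iio (t + 1), isOpen_Iio, by simp, fun x hx => ⟨hx.2, hx.1.le⟩⟩

end Volterra

/-! ### Volterra operators acting on kernels of the form `C (t - s)` -/

section StationaryKernel

variable {A : Type*} [NormedRing A] [NormedAlgebra ℝ A]

lemma interval_const_mul [CompleteSpace A] {f : ℝ → A} {a b : ℝ} (c : A) (hf : IntervalIntegrable f volume a b) :
    ∫ x in a..b, c * f x = c * ∫ x in a..b, f x :=
  (ContinuousLinearMap.mul ℝ A c).intervalIntegral_comp_comm hf

lemma interval_mul_const [CompleteSpace A] {f : ℝ → A} {a b : ℝ} (c : A) (hf : IntervalIntegrable f volume a b) :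
    ∫ x in a..b, f x * c = (∫ x in a..b, f x) * c :=
  ((ContinuousLinearMap.mul ℝ A).flip c).intervalIntegral_comp_comm hf

/-- The Volterra operator with kernel `Γ` applied in the first variable to `(t, s) ↦ C (t - s)`. -/
noncomputable def leftVolterra (Γ C : ℝ → A) (t s : ℝ) : A :=
  C (t - s) + ∫ u in (0 : ℝ)..t, Γ (t - u) * C (u - s)

/-- The Volterra operator with kernel `Γ` applied in both variables to `(t, s) ↦ C (t - s)`. -/
noncomputable def biVolterra [StarRing A] (Γ C : ℝ → A) (t s : ℝ) : A :=
  leftVolterra Γ C t s + ∫ σ in (0 : ℝ)..s, leftVolterra Γ C t σ * star (Γ (s - σ))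

variable {Γ C : ℝ → A} {S : A}

lemma continuous_leftVolterra (hΓ : Continuous Γ) (hC : Continuous C) (t : ℝ) :
    Continuous (leftVolterra Γ C t) := by
  unfold leftVolterra
  refine (by fun_prop : Continuous fun s => C (t - s)).add ?_
  exact intervalIntegral.continuous_parametric_intervalIntegral_of_continuous' (by fun_prop) 0 t

/-- Translating by `s`, the part of the integral over `[s, t]` together with `C (t - s)` is the
equation for `C` at time `t - s`, so it equals `S`. -/
lemma leftVolterra_eq_of_le (hΓ : Continuous Γ) (hC : Continuous C)
    (hV : ∀ t, 0 ≤ t → C t + ∫ u in (0 : ℝ)..t, Γ (t - u) * C u = S) {t s : ℝ}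
    (hst : s ≤ t) :
    leftVolterra Γ C t s = S + ∫ u in (0 : ℝ)..s, Γ (t - u) * C (u - s) := by
  have hii : ∀ a b, IntervalIntegrable (fun u => Γ (t - u) * C (u - s)) volume a b :=
    fun a b => Continuous.intervalIntegrable (by fun_prop) a b
  unfold leftVolterra
  rw [← intervalIntegral.integral_add_adjacent_intervals (hii 0 s) (hii s t)]
  have h1 : ∫ u in s..t, Γ (t - u) * C (u - s) = ∫ u in (0 : ℝ)..(t - s), Γ (t - s - u) * C u := by
    have := intervalIntegral.integral_comp_sub_right (a := s) (b := t)
      (fun u => Γ (t - s - u) * C u) s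
    rw [sub_self] at this
    rw [← this]
    simp
  rw [h1, ← hV (t - s) (by linarith)]
  abel

variable [StarRing A] [NormedStarGroup A] [StarModule ℝ A]

lemma star_intervalIntegral (f : ℝ → A) (a b : ℝ) :
    star (∫ x in a..b, f x) = ∫ x in a..b, star (f x) := by
  simp only [intervalIntegral.intervalIntegral_eq_integral_uIoc, star_smul, star_trivial]
  congr 1
  exact ((starL' ℝ (A := A)).integral_comp_comm f).symm

variable [CompleteSpace A]

/-- Exchanging the order of integration on the triangle makes the inner integral the adjoint of the
equation for `C` at time `s - u`, that is `S - C (u - s)`. The term with `C (u - s)` cancels the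
integral left over from `leftVolterra_eq_of_le`. -/
lemma biVolterra_eq_of_le (hΓ : Continuous Γ) (hC : Continuous C)
    (hV : ∀ t, 0 ≤ t → C t + ∫ u in (0 : ℝ)..t, Γ (t - u) * C u = S)
    (hS : star S = S) (hCs : ∀ x, star (C x) = C (-x)) {t s : ℝ} (hs : 0 ≤ s) (hst : s ≤ t) :
    biVolterra Γ C t s = S + ∫ u in (0 : ℝ)..s, (Γ (t - u) * S + S * star (Γ u)) := by
  have h1 : ∫ σ in (0 : ℝ)..s, leftVolterra Γ C t σ * star (Γ (s - σ))
      = (∫ σ in (0 : ℝ)..s, S * star (Γ (s - σ)))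
        + ∫ σ in (0 : ℝ)..s, ∫ u in (0 : ℝ)..σ, Γ (t - u) * C (u - σ) * star (Γ (s - σ)) := by
    rw [← intervalIntegral.integral_add]
    · refine intervalIntegral.integral_congr fun σ hσ => ?_
      rw [uIcc_of_le hs] at hσ
      rw [leftVolterra_eq_of_le hΓ hC hV (hσ.2.trans hst), add_mul,
        interval_mul_const _ (Continuous.intervalIntegrable (by fun_prop) _ _)]
    · exact Continuous.intervalIntegrable (by fun_prop) _ _
    · refine Continuous.intervalIntegrable ?_ _ _
      exact intervalIntegral.continuous_parametric_intervalIntegral_of_continuous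
        (f := fun σ u => Γ (t - u) * C (u - σ) * star (Γ (s - σ))) (by fun_prop) continuous_id
  have h2 : ∫ σ in (0 : ℝ)..s, ∫ u in (0 : ℝ)..σ, Γ (t - u) * C (u - σ) * star (Γ (s - σ))
      = ∫ u in (0 : ℝ)..s, (Γ (t - u) * S - Γ (t - u) * C (u - s)) := by
    rw [integral_triangle_swap_of_continuous hs
      (f := fun u σ => Γ (t - u) * C (u - σ) * star (Γ (s - σ))) (by fun_prop)]
    refine intervalIntegral.integral_congr fun u hu => ?_
    rw [uIcc_of_le hs] at hu
    simp only [mul_assoc]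
    rw [interval_const_mul _ (Continuous.intervalIntegrable (by fun_prop) _ _), ← mul_sub]
    congr 1
    rw [← star_inj, star_intervalIntegral, star_sub, hS, hCs, neg_sub]
    simp only [star_mul, star_star, hCs, neg_sub]
    have h' := intervalIntegral.integral_comp_sub_right (a := u) (b := s)
      (fun x => Γ (s - u - x) * C x) u
    simp only [sub_self, sub_sub_sub_cancel_right] at h'
    rw [h', ← hV (s - u) (by linarith [hu.2])]
    abel
  have h3 : ∫ σ in (0 : ℝ)..s, S * star (Γ (s - σ)) = ∫ u in (0 : ℝ)..s, S * star (Γ u) := by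
    rw [intervalIntegral.integral_comp_sub_left (fun x => S * star (Γ x))]
    simp
  unfold biVolterra
  rw [h1, h2, h3, leftVolterra_eq_of_le hΓ hC hV hst, intervalIntegral.integral_sub,
    intervalIntegral.integral_add]
  · abel
  all_goals exact Continuous.intervalIntegrable (by fun_prop) _ _

/-- Fully expanded, the expression has four terms; the adjoint exchanges the two single integrals
and, by Fubini on a rectangle, preserves the form of the double one. This carries formulas from `s ≤
t` to `t ≤ s`. -/
lemma star_biVolterra (hΓ : Continuous Γ) (hC : Continuous C)
    (hCs : ∀ x, star (C x) = C (-x)) (t s : ℝ) :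
    star (biVolterra Γ C t s) = biVolterra Γ C s t := by
  have key : ∀ t s, biVolterra Γ C t s = C (t - s) + (∫ u in (0 : ℝ)..t, Γ (t - u) * C (u - s))
      + ((∫ σ in (0 : ℝ)..s, C (t - σ) * star (Γ (s - σ)))
        + ∫ σ in (0 : ℝ)..s, ∫ u in (0 : ℝ)..t, Γ (t - u) * C (u - σ) * star (Γ (s - σ))) := by
    intro t s
    unfold biVolterra leftVolterra
    rw [← intervalIntegral.integral_add]
    · congr 1
      refine intervalIntegral.integral_congr fun σ _ => ?_
      rw [add_mul, interval_mul_const _ (Continuous.intervalIntegrable (by fun_prop) _ _)]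
    · exact Continuous.intervalIntegrable (by fun_prop) _ _
    · refine Continuous.intervalIntegrable ?_ _ _
      exact intervalIntegral.continuous_parametric_intervalIntegral_of_continuous'
        (f := fun σ u => Γ (t - u) * C (u - σ) * star (Γ (s - σ))) (by fun_prop) 0 t
  rw [key, key]
  simp only [star_add, star_intervalIntegral, star_mul, star_star, hCs, neg_sub]
  rw [intervalIntegral_intervalIntegral_swap]
  · simp only [mul_assoc]
    abel
  · refine (Continuous.continuousOn ?_).integrableOn_compact (isCompact_uIcc.prod isCompact_uIcc)
      |>.mono_set (Set.prod_mono uIoc_subset_uIcc uIoc_subset_uIcc)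
    fun_prop

end StationaryKernel

/-- A continuous function `D` with `D 0 = 0` vanishes on `[0, ∞)` as soon as the integrals of
`u ↦ D (t - u) + D u ^*` over `[0, s]` vanish for all `0 ≤ s ≤ t`. -/
lemma eq_zero_of_integral_add_star_eq_zero {A : Type*} [NormedRing A] [NormedAlgebra ℝ A]
    [StarRing A] [NormedStarGroup A] [CompleteSpace A] {D : ℝ → A} (hD : Continuous D)
    (hD0 : D 0 = 0)
    (h : ∀ s t, 0 ≤ s → s ≤ t → ∫ u in (0 : ℝ)..s, (D (t - u) + star (D u)) = 0) :
    ∀ t, 0 ≤ t → D t = 0 := by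
  intro t ht
  rcases ht.eq_or_lt with rfl | ht'
  · exact hD0
  have hc : Continuous fun u => D (t - u) + star (D u) := by fun_prop
  -- With `t` fixed, the one-sided derivative at `s = 0` is `D t + star (D 0)`, and it must be zero.
  have h1 := (hc.integral_hasStrictDerivAt 0 0).hasDerivAt.hasDerivWithinAt (s := Icc 0 t)
  have h2 : HasDerivWithinAt (fun s => ∫ u in (0 : ℝ)..s, (D (t - u) + star (D u))) 0
      (Icc 0 t) 0 :=
    (hasDerivWithinAt_const 0 (Icc 0 t) (0 : A)).congr (fun s hs => h s t hs.1 hs.2) (by simp)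
  have h3 := (uniqueDiffOn_Icc ht' 0 ⟨le_rfl, ht⟩).eq_deriv _ h1 h2
  simpa [hD0] using h3

/-- Lebesgue differentiation on each `[0, n]`; countably many `n` leave a single null set, off which
`f t` is the derivative of the zero function. -/
lemma ae_eq_zero_of_integral_eq_zero {G : Type*} [NormedAddCommGroup G] [NormedSpace ℝ G]
    [CompleteSpace G] {f : ℝ → G} (hf : ∀ T, 0 ≤ T → IntervalIntegrable f volume 0 T)
    (h : ∀ x, 0 ≤ x → ∫ t in (0 : ℝ)..x, f t = 0) :
    ∀ᵐ t ∂(volume.restrict (Ici (0 : ℝ))), f t = 0 := by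
  have h1 : ∀ᵐ t : ℝ, ∀ n : ℕ, t ∈ uIcc (0 : ℝ) n → ∀ c ∈ uIcc (0 : ℝ) n,
      HasDerivAt (fun x => ∫ (t : ℝ) in c..x, f t) (f t) t :=
    ae_all_iff.2 fun n => (hf n n.cast_nonneg).ae_hasDerivAt_integral
  have h2 : ∀ᵐ t : ℝ, t ≠ 0 := by simp [ae_iff]
  rw [ae_restrict_iff' measurableSet_Ici]
  filter_upwards [h1, h2] with t ht ht0 htpos
  have htpos' : 0 < t := lt_of_le_of_ne htpos (Ne.symm ht0)
  obtain ⟨n, hn⟩ := exists_nat_ge t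
  have h3 := ht n (by rw [uIcc_of_le n.cast_nonneg]; exact ⟨htpos, hn⟩) 0 left_mem_uIcc
  have h4 : HasDerivAt (fun x => ∫ (t : ℝ) in (0 : ℝ)..x, f t) 0 t := by
    refine (hasDerivAt_const t (0 : G)).congr_of_eventuallyEq ?_
    filter_upwards [Ioi_mem_nhds htpos'] with x hx using h x (le_of_lt hx)
  exact h3.unique h4

/-! ### Calculus of operator-valued second moments -/

section SecondMoments

lemma memLp_two_prod {Ω α E : Type*} [MeasurableSpace Ω] [MeasurableSpace α] {P : Measure Ω}
    [IsFiniteMeasure P] {μ : Measure α} [IsFiniteMeasure μ] [NormedAddCommGroup E]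
    {X : α → Ω → E} {K : ℝ}
    (hX : AEStronglyMeasurable (fun p : α × Ω => X p.1 p.2) (μ.prod P))
    (h2 : ∀ᵐ s ∂μ, MemLp (X s) 2 P) (hK : ∀ᵐ s ∂μ, ∫ ω, ‖X s ω‖ ^ 2 ∂P ≤ K) :
    MemLp (fun p : α × Ω => X p.1 p.2) 2 (μ.prod P) := by
  rw [memLp_two_iff_integrable_sq_norm hX]
  have hX' : AEStronglyMeasurable (fun p : α × Ω => ‖X p.1 p.2‖ ^ 2) (μ.prod P) := hX.norm.pow 2
  rw [integrable_prod_iff hX']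
  refine ⟨?_, ?_⟩
  · filter_upwards [h2] with s hs
    exact (memLp_two_iff_integrable_sq_norm hs.1).1 hs
  · refine (integrable_const K).mono' hX'.norm.integral_prod_right' ?_
    filter_upwards [hK] with s hs
    rw [Real.norm_of_nonneg (by positivity)]
    simpa using hs

variable {Ω : Type*} [MeasurableSpace Ω] {P : Measure Ω}
  {E : Type*} [NormedAddCommGroup E] [InnerProductSpace ℝ E]

/-- The second moment `𝔼 (X Y^*)` as an operator: the expectation of the rank one operators
`X ⊗ Y^*`. -/
noncomputable def secondMoment (P : Measure Ω) (X Y : Ω → E) : E →L[ℝ] E :=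
  ∫ ω, InnerProductSpace.rankOne ℝ (X ω) (Y ω) ∂P

variable {X Y Z : Ω → E}

lemma aestronglyMeasurable_rankOne (hX : AEStronglyMeasurable X P)
    (hY : AEStronglyMeasurable Y P) :
    AEStronglyMeasurable (fun ω => InnerProductSpace.rankOne ℝ (X ω) (Y ω)) P :=
  (InnerProductSpace.rankOne ℝ (E := E) (F := E)).continuous₂.comp_aestronglyMeasurable₂ hX hY

lemma integrable_rankOne (hX : MemLp X 2 P) (hY : MemLp Y 2 P) :
    Integrable (fun ω => InnerProductSpace.rankOne ℝ (X ω) (Y ω)) P := by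
  refine (hX.norm.integrable_mul hY.norm).mono'
    (aestronglyMeasurable_rankOne hX.aestronglyMeasurable hY.aestronglyMeasurable)
    (Eventually.of_forall fun ω => ?_)
  simp

lemma secondMoment_congr {X' Y' : Ω → E} (hX : X =ᵐ[P] X') (hY : Y =ᵐ[P] Y') :
    secondMoment P X Y = secondMoment P X' Y' := by
  refine integral_congr_ae ?_
  filter_upwards [hX, hY] with ω h1 h2
  rw [h1, h2]

lemma secondMoment_add_left (hX : MemLp X 2 P) (hY : MemLp Y 2 P) (hZ : MemLp Z 2 P) :
    secondMoment P (fun ω => X ω + Y ω) Z = secondMoment P X Z + secondMoment P Y Z := by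
  unfold secondMoment
  rw [← integral_add (integrable_rankOne hX hZ) (integrable_rankOne hY hZ)]
  simp

lemma secondMoment_sub_left (hX : MemLp X 2 P) (hY : MemLp Y 2 P) (hZ : MemLp Z 2 P) :
    secondMoment P (fun ω => X ω - Y ω) Z = secondMoment P X Z - secondMoment P Y Z := by
  unfold secondMoment
  rw [← integral_sub (integrable_rankOne hX hZ) (integrable_rankOne hY hZ)]
  simp

lemma secondMoment_comp_left [CompleteSpace E] (T : E →L[ℝ] E) (hX : MemLp X 2 P) (hY : MemLp Y 2 P) :
    secondMoment P (fun ω => T (X ω)) Y = T * secondMoment P X Y := by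
  unfold secondMoment
  have h := (ContinuousLinearMap.mul ℝ (E →L[ℝ] E) T).integral_comp_comm (integrable_rankOne hX hY)
  simp only [ContinuousLinearMap.mul_apply'] at h
  rw [← h]
  congr 1
  ext1 ω
  exact (InnerProductSpace.comp_rankOne _ _ _).symm

lemma star_secondMoment [CompleteSpace E] (X Y : Ω → E) :
    star (secondMoment P X Y) = secondMoment P Y X := by
  unfold secondMoment
  have h := (starL' ℝ (A := E →L[ℝ] E)).integral_comp_comm (μ := P)
    (fun ω => InnerProductSpace.rankOne ℝ (X ω) (Y ω))
  refine h.symm.trans ?_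
  congr 1
  ext1 ω
  exact InnerProductSpace.adjoint_rankOne _ _

lemma secondMoment_add_right [CompleteSpace E] (hX : MemLp X 2 P) (hY : MemLp Y 2 P) (hZ : MemLp Z 2 P) :
    secondMoment P Z (fun ω => X ω + Y ω) = secondMoment P Z X + secondMoment P Z Y := by
  rw [← star_secondMoment, secondMoment_add_left hX hY hZ, star_add, star_secondMoment,
    star_secondMoment]

/-- Cauchy–Schwarz; it turns mean-square continuity of the noise into continuity of its
autocovariance. -/
lemma enorm_secondMoment_le (hX : AEStronglyMeasurable X P) (hY : AEStronglyMeasurable Y P) :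
    ‖secondMoment P X Y‖ₑ ≤ eLpNorm X 2 P * eLpNorm Y 2 P := by
  refine (enorm_integral_le_lintegral_enorm _).trans ?_
  rw [← eLpNorm_one_eq_lintegral_enorm]
  have := eLpNorm_le_eLpNorm_mul_eLpNorm'_of_norm (p := 2) (q := 2) (r := 1) hX hY
    (fun x y => InnerProductSpace.rankOne ℝ x y) 1 (by simp)
  simpa using this

/-- Pairing with a constant vector encodes a mean as a second moment, so the Volterra equation for
second moments also governs means. -/
lemma secondMoment_const_right [CompleteSpace E] [IsFiniteMeasure P] (hX : MemLp X 2 P) (c : E) :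
    secondMoment P X (fun _ => c) = InnerProductSpace.rankOne ℝ (∫ ω, X ω ∂P) c := by
  have h := ((InnerProductSpace.rankOne ℝ (E := E) (F := E)).flip c).integral_comp_comm
    (hX.integrable (by norm_num))
  exact h

variable {α : Type*} [MeasurableSpace α] {μ : Measure α} [IsFiniteMeasure μ]
  [IsFiniteMeasure P]

lemma sq_norm_integral_le {f : α → E} (hf : MemLp f 2 μ) :
    ‖∫ a, f a ∂μ‖ ^ 2 ≤ μ.real univ * ∫ a, ‖f a‖ ^ 2 ∂μ := by
  have h1 : ‖∫ a, f a ∂μ‖ ≤ ∫ a, ‖f a‖ ∂μ := norm_integral_le_integral_norm _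
  have h2 := integral_mul_le_Lp_mul_Lq_of_nonneg (μ := μ) (p := 2) (q := 2)
    (Real.HolderConjugate.two_two) (f := fun _ => (1 : ℝ)) (g := fun a => ‖f a‖)
    (Eventually.of_forall fun _ => by simp) (Eventually.of_forall fun _ => norm_nonneg _)
    (memLp_const _) (by simpa using hf.norm)
  simp only [one_mul, Real.one_rpow, integral_const, smul_eq_mul, mul_one] at h2
  have h3 : ‖∫ a, f a ∂μ‖ ^ 2 ≤ ((μ.real univ) ^ ((1 : ℝ) / 2) * (∫ a, ‖f a‖ ^ (2 : ℝ) ∂μ) ^ ((1 : ℝ) / 2)) ^ 2 := by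
    gcongr
    exact h1.trans h2
  refine h3.trans_eq ?_
  rw [← Real.sqrt_eq_rpow, ← Real.sqrt_eq_rpow, mul_pow, Real.sq_sqrt (by positivity),
    Real.sq_sqrt (by positivity)]
  simp

/-- Cauchy–Schwarz in `s` for almost every `ω`, then Fubini. -/
lemma memLp_two_integral_prod {W : α × Ω → E} (hW : MemLp W 2 (μ.prod P)) :
    MemLp (fun ω => ∫ s, W (s, ω) ∂μ) 2 P ∧
      ∫ ω, ‖∫ s, W (s, ω) ∂μ‖ ^ 2 ∂P ≤ μ.real univ * ∫ s, ∫ ω, ‖W (s, ω)‖ ^ 2 ∂P ∂μ := by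
  have h1 : Integrable (fun p => ‖W p‖ ^ 2) (μ.prod P) :=
    (memLp_two_iff_integrable_sq_norm hW.1).1 hW
  have h2 : ∀ᵐ ω ∂P, ‖∫ s, W (s, ω) ∂μ‖ ^ 2 ≤ μ.real univ * ∫ s, ‖W (s, ω)‖ ^ 2 ∂μ := by
    have h3 := h1.prod_left_ae
    have h4 := (hW.1.prod_swap).prodMk_left
    filter_upwards [h3, h4] with ω h3 h4
    exact sq_norm_integral_le ((memLp_two_iff_integrable_sq_norm h4).2 h3)
  have hm : AEStronglyMeasurable (fun ω => ∫ s, W (s, ω) ∂μ) P :=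
    hW.1.prod_swap.integral_prod_right'
  have hi : Integrable (fun ω => ‖∫ s, W (s, ω) ∂μ‖ ^ 2) P := by
    refine (h1.integral_prod_right.const_mul (μ.real univ)).mono' (hm.norm.pow 2) ?_
    filter_upwards [h2] with ω h
    rwa [Real.norm_of_nonneg (by positivity)]
  refine ⟨(memLp_two_iff_integrable_sq_norm hm).2 hi, ?_⟩
  refine (integral_mono_ae hi (h1.integral_prod_right.const_mul (μ.real univ)) h2).trans_eq ?_
  rw [integral_const_mul]
  congr 1
  exact (integral_integral_swap (f := fun s ω => ‖W (s, ω)‖ ^ 2) h1).symm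

lemma secondMoment_integral [CompleteSpace E] {W : α × Ω → E} (hW : MemLp W 2 (μ.prod P)) (hZ : MemLp Z 2 P) :
    Integrable (fun s => secondMoment P (fun ω => W (s, ω)) Z) μ ∧
    secondMoment P (fun ω => ∫ s, W (s, ω) ∂μ) Z
      = ∫ s, secondMoment P (fun ω => W (s, ω)) Z ∂μ := by
  have h1 : Integrable (fun p : α × Ω => InnerProductSpace.rankOne ℝ (W p) (Z p.2)) (μ.prod P) :=
    integrable_rankOne hW (hZ.comp_snd μ)
  refine ⟨h1.integral_prod_left, ?_⟩
  unfold secondMoment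
  rw [integral_integral_swap h1]
  refine integral_congr_ae ?_
  have h2 : Integrable W (μ.prod P) := hW.integrable (by norm_num)
  filter_upwards [h2.prod_left_ae] with ω hω
  exact (((InnerProductSpace.rankOne ℝ (E := E) (F := E)).flip (Z ω)).integral_comp_comm hω).symm

end SecondMoments

/-! ### Square integrability of solutions with integrable paths -/

section SquareIntegrability

variable {Ω : Type*} [MeasurableSpace Ω] {P : Measure Ω} {E : Type*} [NormedAddCommGroup E]

/-- Fatou's lemma applied to the squared norms. -/
lemma memLp_two_and_le_of_tendsto {X : ℕ → Ω → E} {Z : Ω → E} {K : ℝ}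
    (hX : ∀ n, MemLp (X n) 2 P) (hK : ∀ n, ∫ ω, ‖X n ω‖ ^ 2 ∂P ≤ K)
    (hZ : AEStronglyMeasurable Z P)
    (hlim : ∀ᵐ ω ∂P, Tendsto (fun n => X n ω) atTop (𝓝 (Z ω))) :
    MemLp Z 2 P ∧ ∫ ω, ‖Z ω‖ ^ 2 ∂P ≤ K := by
  have hK0 : 0 ≤ K := (integral_nonneg fun ω => by positivity).trans (hK 0)
  have h1 : ∀ n, ∫⁻ ω, ENNReal.ofReal (‖X n ω‖ ^ 2) ∂P ≤ ENNReal.ofReal K := fun n => by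
    rw [← ofReal_integral_eq_lintegral_ofReal
      ((memLp_two_iff_integrable_sq_norm (hX n).1).1 (hX n))
      (Eventually.of_forall fun _ => by positivity)]
    exact ENNReal.ofReal_le_ofReal (hK n)
  have h2 : ∫⁻ ω, ENNReal.ofReal (‖Z ω‖ ^ 2) ∂P ≤ ENNReal.ofReal K := by
    calc ∫⁻ ω, ENNReal.ofReal (‖Z ω‖ ^ 2) ∂P
        = ∫⁻ ω, liminf (fun n => ENNReal.ofReal (‖X n ω‖ ^ 2)) atTop ∂P := by
          refine lintegral_congr_ae ?_
          filter_upwards [hlim] with ω h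
          exact (ENNReal.tendsto_ofReal (h.norm.pow 2)).liminf_eq.symm
      _ ≤ liminf (fun n => ∫⁻ ω, ENNReal.ofReal (‖X n ω‖ ^ 2) ∂P) atTop :=
          lintegral_liminf_le' fun n => ((hX n).1.norm.pow 2).aemeasurable.ennreal_ofReal
      _ ≤ ENNReal.ofReal K := by
          refine (liminf_le_liminf (Eventually.of_forall h1)).trans ?_
          simp
  have h3 : AEStronglyMeasurable (fun ω => ‖Z ω‖ ^ 2) P := hZ.norm.pow 2
  refine ⟨(memLp_two_iff_integrable_sq_norm hZ).2 ⟨h3, ?_⟩, ?_⟩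
  · rw [hasFiniteIntegral_iff_ofReal (Eventually.of_forall fun _ => by positivity)]
    exact h2.trans_lt ENNReal.ofReal_lt_top
  · rw [integral_eq_lintegral_of_nonneg_ae (Eventually.of_forall fun _ => by positivity) h3]
    exact ENNReal.toReal_le_of_le_ofReal hK0 h2

lemma sq_norm_sub_le (x y : E) : ‖x - y‖ ^ 2 ≤ 2 * ‖x‖ ^ 2 + 2 * ‖y‖ ^ 2 := by
  have h1 := norm_sub_le x y
  have h2 := norm_nonneg (x - y)
  nlinarith [sq_nonneg (‖x‖ - ‖y‖)]

variable [InnerProductSpace ℝ E]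

lemma aestronglyMeasurable_clm_process {A : ℝ → E →L[ℝ] E} (hA : Continuous A) {V : ℝ → Ω → E}
    {μ : Measure ℝ} (hV : AEStronglyMeasurable (fun p : ℝ × Ω => V p.1 p.2) (μ.prod P)) :
    AEStronglyMeasurable (fun p : ℝ × Ω => A p.1 (V p.1 p.2)) (μ.prod P) := by
  have h1 : AEStronglyMeasurable (fun p : ℝ × Ω => A p.1) (μ.prod P) :=
    (hA.stronglyMeasurable.comp_measurable measurable_fst).aestronglyMeasurable
  exact (ContinuousLinearMap.id ℝ (E →L[ℝ] E)).aestronglyMeasurable_comp₂ h1 hV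

variable [IsFiniteMeasure P]

lemma memLp_two_clm_process {A : ℝ → E →L[ℝ] E} (hA : Continuous A) {g : ℝ}
    (hg : ∀ x, ‖A x‖ ≤ g) {V : ℝ → Ω → E} {μ : Measure ℝ} [SFinite μ]
    (hV : MemLp (fun p : ℝ × Ω => V p.1 p.2) 2 (μ.prod P)) :
    MemLp (fun p : ℝ × Ω => A p.1 (V p.1 p.2)) 2 (μ.prod P) := by
  refine hV.of_le_mul (c := g) (aestronglyMeasurable_clm_process hA hV.1)
    (Eventually.of_forall fun p => ?_)
  exact ((A p.1).le_opNorm _).trans (by gcongr; exact hg _)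

lemma prod_restrict_Ioc_ac {t T : ℝ} (h : t ≤ T) :
    (volume.restrict (Ioc 0 t)).prod P ≤ (volume.restrict (Icc 0 T)).prod P :=
  Measure.prod_mono (Measure.restrict_mono
    (Ioc_subset_Icc_self.trans (Icc_subset_Icc_right h)) le_rfl) le_rfl

variable [CompleteSpace E]

/-- If a process `W` satisfies a Volterra equation with square integrable right-hand side and is
uniformly square integrable, then its second moments obey a bound depending on the right-hand side
only. -/
lemma integral_sq_norm_le_of_volterra {Γ : ℝ → E →L[ℝ] E} {g : ℝ} (hΓ : Continuous Γ)
    (hg : ∀ x, ‖Γ x‖ ≤ g) {W Y : ℝ → Ω → E} {T K : ℝ}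
    (hW : MemLp (fun p : ℝ × Ω => W p.1 p.2) 2 ((volume.restrict (Icc 0 T)).prod P))
    (hWt : ∀ t ∈ Icc 0 T, MemLp (W t) 2 P)
    (hY2 : ∀ t ∈ Icc 0 T, MemLp (Y t) 2 P) (hYK : ∀ t ∈ Icc 0 T, ∫ ω, ‖Y t ω‖ ^ 2 ∂P ≤ K)
    (heq : ∀ t ∈ Icc 0 T, ∀ᵐ ω ∂P,
      ‖W t ω‖ ≤ ‖Y t ω - ∫ s in (0 : ℝ)..t, Γ (t - s) (W s ω)‖) :
    ∀ t ∈ Icc 0 T, ∫ ω, ‖W t ω‖ ^ 2 ∂P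
      ≤ 2 * (2 * K) * Real.exp (2 * (2 * T * g ^ 2 + 1) * T) := by
  intro t ht
  have hT : 0 ≤ T := ht.1.trans ht.2
  have hK0 : 0 ≤ K := (integral_nonneg fun ω => by positivity).trans (hYK t ht)
  have hsq : Integrable (fun p : ℝ × Ω => ‖W p.1 p.2‖ ^ 2) ((volume.restrict (Icc 0 T)).prod P) :=
    (memLp_two_iff_integrable_sq_norm hW.1).1 hW
  have hf : IntegrableOn (fun t => ∫ ω, ‖W t ω‖ ^ 2 ∂P) (Icc 0 T) := hsq.integral_prod_left
  -- Both factors 2 come from `sq_norm_sub_le`; `T * g ^ 2` comes from Cauchy–Schwarz on `[0, t]`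
  -- with `t ≤ T`. The added 1 keeps the rate positive.
  have key := gronwall_of_integrable (f := fun t => ∫ ω, ‖W t ω‖ ^ 2 ∂P) (T := T) (a := 2 * K)
    (b := 2 * T * g ^ 2 + 1) (by positivity) (by positivity) hf
    (fun _ _ => integral_nonneg fun ω => by positivity) ?_ t ht
  · refine key.trans ?_
    have := ht.2
    gcongr
  intro t ht
  have hWp : MemLp (fun p : ℝ × Ω => Γ (t - p.1) (W p.1 p.2)) 2
      ((volume.restrict (Ioc 0 t)).prod P) :=
    memLp_two_clm_process (A := fun s => Γ (t - s)) (by fun_prop) (fun s => hg _)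
      (hW.mono_measure (prod_restrict_Ioc_ac ht.2))
  obtain ⟨hU, hUle⟩ := memLp_two_integral_prod hWp
  simp only [← intervalIntegral.integral_of_le ht.1] at hU hUle
  set U : Ω → E := fun ω => ∫ s in (0 : ℝ)..t, Γ (t - s) (W s ω) with hUdef
  have hUi := (memLp_two_iff_integrable_sq_norm hU.1).1 hU
  have hYi := (memLp_two_iff_integrable_sq_norm (hY2 t ht).1).1 (hY2 t ht)
  have hWi := (memLp_two_iff_integrable_sq_norm (hWt t ht).1).1 (hWt t ht)
  have h1 : ∫ ω, ‖W t ω‖ ^ 2 ∂P ≤ ∫ ω, (2 * ‖Y t ω‖ ^ 2 + 2 * ‖U ω‖ ^ 2) ∂P := by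
    refine integral_mono_ae hWi ((hYi.const_mul 2).add (hUi.const_mul 2)) ?_
    filter_upwards [heq t ht] with ω hω
    refine le_trans ?_ (sq_norm_sub_le (Y t ω) (U ω))
    gcongr
  rw [integral_add (hYi.const_mul 2) (hUi.const_mul 2), integral_const_mul,
    integral_const_mul] at h1
  have hft : IntegrableOn (fun t => ∫ ω, ‖W t ω‖ ^ 2 ∂P) (Ioc 0 t) :=
    hf.mono_set (Ioc_subset_Icc_self.trans (Icc_subset_Icc_right ht.2))
  have h2 : ∫ s in (0 : ℝ)..t, ∫ ω, ‖Γ (t - s) (W s ω)‖ ^ 2 ∂P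
      ≤ g ^ 2 * ∫ s in (0 : ℝ)..t, ∫ ω, ‖W s ω‖ ^ 2 ∂P := by
    rw [← intervalIntegral.integral_const_mul, intervalIntegral.integral_of_le ht.1,
      intervalIntegral.integral_of_le ht.1]
    refine setIntegral_mono_on ?_ (hft.const_mul _) measurableSet_Ioc fun s hs => ?_
    · exact ((memLp_two_iff_integrable_sq_norm hWp.1).1 hWp).integral_prod_left
    · rw [← integral_const_mul]
      have hs' := hWt s ⟨hs.1.le, hs.2.trans ht.2⟩
      refine integral_mono_of_nonneg (Eventually.of_forall fun _ => by positivity)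
        (((memLp_two_iff_integrable_sq_norm hs'.1).1 hs').const_mul _)
        (Eventually.of_forall fun ω => ?_)
      simp only [← mul_pow]
      gcongr
      exact ((Γ (t - s)).le_opNorm _).trans (by gcongr; exact hg _)
  have hI0 : 0 ≤ ∫ s in (0 : ℝ)..t, ∫ ω, ‖W s ω‖ ^ 2 ∂P :=
    intervalIntegral.integral_nonneg ht.1 fun _ _ => integral_nonneg fun ω => by positivity
  have hvol : (volume.restrict (Ioc 0 t)).real univ = t := by
    simp [Measure.real, ht.1]
  rw [hvol] at hUle
  have h3 : ∫ ω, ‖U ω‖ ^ 2 ∂P ≤ T * (g ^ 2 * ∫ s in (0 : ℝ)..t, ∫ ω, ‖W s ω‖ ^ 2 ∂P) := by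
    refine hUle.trans (mul_le_mul ht.2 h2 ?_ hT)
    exact intervalIntegral.integral_nonneg ht.1 fun _ _ => integral_nonneg fun ω => by positivity
  have h4 := hYK t ht
  nlinarith

/-- Solutions of a linear Volterra equation with square integrable right-hand side and integrable
paths are square integrable. -/
lemma memLp_two_of_volterra {Γ : ℝ → E →L[ℝ] E} {g : ℝ} (hΓ : Continuous Γ)
    (hg : ∀ x, ‖Γ x‖ ≤ g) {V Y : ℝ → Ω → E} {T K : ℝ}
    (hV : AEStronglyMeasurable (fun p : ℝ × Ω => V p.1 p.2) ((volume.restrict (Icc 0 T)).prod P))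
    (hint : ∀ᵐ ω ∂P, IntegrableOn (fun t => V t ω) (Icc 0 T))
    (hY2 : ∀ t ∈ Icc 0 T, MemLp (Y t) 2 P) (hYK : ∀ t ∈ Icc 0 T, ∫ ω, ‖Y t ω‖ ^ 2 ∂P ≤ K)
    (heq : ∀ t ∈ Icc 0 T, ∀ᵐ ω ∂P,
      V t ω + ∫ s in (0 : ℝ)..t, Γ (t - s) (V s ω) = Y t ω) :
    ∃ K', ∀ t ∈ Icc 0 T, MemLp (V t) 2 P ∧ ∫ ω, ‖V t ω‖ ^ 2 ∂P ≤ K' := by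
  have hg0 : 0 ≤ g := (norm_nonneg _).trans (hg 0)
  have hVt : ∀ t ∈ Icc 0 T, AEStronglyMeasurable (V t) P := fun t ht => by
    have h1 : AEStronglyMeasurable (fun p : ℝ × Ω => Γ (t - p.1) (V p.1 p.2))
        ((volume.restrict (Ioc 0 t)).prod P) :=
      aestronglyMeasurable_clm_process (A := fun s => Γ (t - s)) (by fun_prop)
        (hV.mono_measure (prod_restrict_Ioc_ac ht.2))
    have h2 : AEStronglyMeasurable (fun ω => ∫ s in (0 : ℝ)..t, Γ (t - s) (V s ω)) P := by
      simp only [intervalIntegral.integral_of_le ht.1]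
      exact h1.prod_swap.integral_prod_right'
    refine ((hY2 t ht).1.sub h2).congr ?_
    filter_upwards [heq t ht] with ω hω
    simp [← hω]
  have hJ : AEStronglyMeasurable (fun ω => ∫ s in Icc 0 T, ‖V s ω‖) P :=
    hV.norm.prod_swap.integral_prod_right'
  set J := hJ.mk with hJdef
  have hJae : ∀ᵐ ω ∂P, ∫ s in Icc 0 T, ‖V s ω‖ = J ω := hJ.ae_eq_mk
  -- The event bounds the `L¹` norm of the whole path on `[0, T]`. As it does not depend on time,
  -- truncation commutes with the time integral.
  let A : ℕ → Set Ω := fun n => {ω | J ω ≤ n}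
  have hA : ∀ n, MeasurableSet (A n) := fun n =>
    measurableSet_le hJ.stronglyMeasurable_mk.measurable measurable_const
  let W : ℕ → ℝ → Ω → E := fun n s => (A n).indicator (V s)
  have hWmeas : ∀ n, AEStronglyMeasurable (fun p : ℝ × Ω => W n p.1 p.2)
      ((volume.restrict (Icc 0 T)).prod P) := fun n => by
    refine (hV.indicator (s := univ ×ˢ A n) (MeasurableSet.univ.prod (hA n))).congr
      (Eventually.of_forall fun p => ?_)
    simp [W, indicator]
  -- This bound depends on `n`; it only makes `W n` square integrable, so that Gronwall can be
  -- applied and return a bound free of `n`.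
  have hpath : ∀ n, ∀ t ∈ Icc 0 T, ∀ᵐ ω ∂P, ‖W n t ω‖ ≤ ‖Y t ω‖ + g * n := fun n t ht => by
    filter_upwards [heq t ht, hint, hJae] with ω h1 h2 h3
    by_cases hω : ω ∈ A n
    · simp only [W, indicator_of_mem hω]
      have h4 : ‖∫ s in (0 : ℝ)..t, Γ (t - s) (V s ω)‖ ≤ g * n := by
        have h5 : IntervalIntegrable (fun s => ‖V s ω‖) volume 0 t := by
          rw [intervalIntegrable_iff_integrableOn_Icc_of_le ht.1]
          exact (h2.mono_set (Icc_subset_Icc_right ht.2)).norm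
        calc ‖∫ s in (0 : ℝ)..t, Γ (t - s) (V s ω)‖ ≤ ∫ s in (0 : ℝ)..t, g * ‖V s ω‖ := by
              refine intervalIntegral.norm_integral_le_of_norm_le ht.1 ?_ (h5.const_mul g)
              exact Eventually.of_forall fun s _ =>
                ((Γ (t - s)).le_opNorm _).trans (by gcongr; exact hg _)
          _ = g * ∫ s in (0 : ℝ)..t, ‖V s ω‖ := intervalIntegral.integral_const_mul _ _
          _ ≤ g * n := by
              gcongr
              refine le_trans ?_ (h3.trans_le hω)
              rw [intervalIntegral.integral_of_le ht.1]
              exact setIntegral_mono_set h2.norm (Eventually.of_forall fun _ => norm_nonneg _)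
                (Eventually.of_forall (Ioc_subset_Icc_self.trans (Icc_subset_Icc_right ht.2)))
      have h5 : V t ω = Y t ω - ∫ s in (0 : ℝ)..t, Γ (t - s) (V s ω) := by simp [← h1]
      rw [h5]
      exact (norm_sub_le _ _).trans (by gcongr)
    · simp only [W, indicator_of_notMem hω, norm_zero]
      positivity
  have hWt : ∀ n, ∀ t ∈ Icc 0 T, MemLp (W n t) 2 P := fun n t ht => by
    refine ((hY2 t ht).norm.add (memLp_const (g * n))).mono' ((hVt t ht).indicator (hA n)) ?_
    simpa using hpath n t ht
  have hWK : ∀ n, ∀ t ∈ Icc 0 T, ∫ ω, ‖W n t ω‖ ^ 2 ∂P ≤ 2 * K + 2 * (g * n) ^ 2 * P.real univ :=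
    fun n t ht => by
    have hYi := (memLp_two_iff_integrable_sq_norm (hY2 t ht).1).1 (hY2 t ht)
    have h1 : ∫ ω, ‖W n t ω‖ ^ 2 ∂P ≤ ∫ ω, (2 * ‖Y t ω‖ ^ 2 + 2 * (g * n) ^ 2) ∂P := by
      refine integral_mono_ae ((memLp_two_iff_integrable_sq_norm (hWt n t ht).1).1 (hWt n t ht))
        ((hYi.const_mul 2).add (integrable_const _)) ?_
      filter_upwards [hpath n t ht] with ω hω
      have h2 : ‖W n t ω‖ ^ 2 ≤ (‖Y t ω‖ + g * n) ^ 2 := by gcongr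
      nlinarith [sq_nonneg (‖Y t ω‖ - g * n)]
    rw [integral_add (hYi.const_mul 2) (integrable_const _), integral_const_mul, integral_const,
      smul_eq_mul] at h1
    have := hYK t ht
    linarith
  have hWp : ∀ n, MemLp (fun p : ℝ × Ω => W n p.1 p.2) 2 ((volume.restrict (Icc 0 T)).prod P) :=
    fun n => memLp_two_prod (hWmeas n) (ae_restrict_of_forall_mem measurableSet_Icc (hWt n))
      (ae_restrict_of_forall_mem measurableSet_Icc (hWK n))
  refine ⟨2 * (2 * K) * Real.exp (2 * (2 * T * g ^ 2 + 1) * T), fun t ht => ?_⟩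
  refine memLp_two_and_le_of_tendsto (fun n => hWt n t ht) (fun n => ?_) (hVt t ht) ?_
  -- On `A n` the truncated process satisfies the original equation; off `A n` it is zero while `Y`
  -- need not be. Hence an inequality of norms is used instead of an equation.
  · refine integral_sq_norm_le_of_volterra hΓ hg (hWp n) (hWt n) hY2 hYK (fun t ht => ?_) t ht
    filter_upwards [heq t ht] with ω hω
    by_cases hωA : ω ∈ A n
    · simp only [W, indicator_of_mem hωA]
      simp [← hω]
    · simp [W, indicator_of_notMem hωA]
  · refine Eventually.of_forall fun ω => ?_
    refine tendsto_const_nhds.congr' ?_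
    obtain ⟨N, hN⟩ := exists_nat_ge (J ω)
    filter_upwards [eventually_ge_atTop N] with n hn
    have : ω ∈ A n := hN.trans (by exact_mod_cast hn)
    simp [W, indicator_of_mem this]

end SquareIntegrability

/-! ### Extension of autocovariances to negative lags -/

section HermitianExtension

variable {A : Type*} [NormedRing A] [NormedAlgebra ℝ A] [StarRing A] [NormedStarGroup A]

/-- The extension of a function on `[0, ∞)` to the real line with `f (-x) = (f x)^*`. -/
noncomputable def hermitianExtension (f : ℝ → A) (x : ℝ) : A :=
  if 0 ≤ x then f x else star (f (-x))

variable {f : ℝ → A}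

lemma hermitianExtension_of_nonneg {x : ℝ} (hx : 0 ≤ x) : hermitianExtension f x = f x :=
  if_pos hx

lemma star_hermitianExtension (h0 : star (f 0) = f 0) (x : ℝ) :
    star (hermitianExtension f x) = hermitianExtension f (-x) := by
  unfold hermitianExtension
  rcases lt_trichotomy x 0 with h | rfl | h
  · rw [if_neg h.not_ge, if_pos (by linarith), star_star]
  · simp [h0]
  · rw [if_pos h.le, if_neg (by linarith), neg_neg]

lemma continuous_hermitianExtension (hf : ContinuousOn f (Ici 0)) (h0 : star (f 0) = f 0) :
    Continuous (hermitianExtension f) := by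
  have h1 : Continuous fun x => f |x| := hf.comp_continuous continuous_abs fun x => abs_nonneg x
  have h2 : hermitianExtension f = fun x => if 0 ≤ x then f |x| else star (f |x|) := by
    ext x
    unfold hermitianExtension
    split_ifs with h
    · rw [abs_of_nonneg h]
    · rw [abs_of_neg (not_le.1 h)]
  rw [h2]
  refine h1.if_le h1.star continuous_const continuous_id fun x hx => ?_
  simp [← hx, h0]

end HermitianExtension

/-! ### The stationarity criterion for abstract Volterra processes -/

section VolterraProcess

variable {Ω : Type*} [MeasurableSpace Ω]
  {E : Type*} [NormedAddCommGroup E] [InnerProductSpace ℝ E] [CompleteSpace E]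

/-- A process which is square integrable at each time and on bounded time intervals. -/
structure IsSquareIntegrableProcess (P : Measure Ω) (X : ℝ → Ω → E) : Prop where
  memLp : ∀ t, 0 ≤ t → MemLp (X t) 2 P
  memLp_prod : ∀ T, MemLp (fun p : ℝ × Ω => X p.1 p.2) 2 ((volume.restrict (Icc 0 T)).prod P)

/-- `V + Γ * V = V₀ + ∫ F` in a second order setting. -/
structure IsVolterraProcess (P : Measure Ω) (Γ : ℝ → E →L[ℝ] E) (g : ℝ) (V₀ : Ω → E)
    (F V : ℝ → Ω → E) : Prop where
  continuous : Continuous Γ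
  bound : ∀ x, ‖Γ x‖ ≤ g
  eq_zero : ∀ x ≤ 0, Γ x = 0
  init : MemLp V₀ 2 P
  noise : IsSquareIntegrableProcess P F
  solution : IsSquareIntegrableProcess P V
  uncorrelated : ∀ t, 0 ≤ t → secondMoment P (F t) V₀ = 0
  equation : ∀ t, 0 ≤ t → ∀ᵐ ω ∂P,
    V t ω + ∫ s in (0 : ℝ)..t, Γ (t - s) (V s ω) = V₀ ω + ∫ s in (0 : ℝ)..t, F s ω

variable {P : Measure Ω} [IsFiniteMeasure P]

lemma IsSquareIntegrableProcess.memLp_prod_Ioc {X : ℝ → Ω → E}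
    (hX : IsSquareIntegrableProcess P X) (t : ℝ) :
    MemLp (fun p : ℝ × Ω => X p.1 p.2) 2 ((volume.restrict (Ioc 0 t)).prod P) :=
  (hX.memLp_prod t).mono_measure (prod_restrict_Ioc_ac le_rfl)

lemma IsSquareIntegrableProcess.memLp_integral {X : ℝ → Ω → E}
    (hX : IsSquareIntegrableProcess P X) {t : ℝ} (ht : 0 ≤ t) :
    MemLp (fun ω => ∫ s in (0 : ℝ)..t, X s ω) 2 P := by
  simp only [intervalIntegral.integral_of_le ht]
  exact (memLp_two_integral_prod (hX.memLp_prod_Ioc t)).1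

lemma IsSquareIntegrableProcess.secondMoment_integral {X : ℝ → Ω → E}
    (hX : IsSquareIntegrableProcess P X) {t : ℝ} (ht : 0 ≤ t) {Z : Ω → E} (hZ : MemLp Z 2 P) :
    secondMoment P (fun ω => ∫ s in (0 : ℝ)..t, X s ω) Z
      = ∫ s in (0 : ℝ)..t, secondMoment P (X s) Z := by
  simp only [intervalIntegral.integral_of_le ht]
  exact (KuboGLE.secondMoment_integral (hX.memLp_prod_Ioc t) hZ).2

lemma IsSquareIntegrableProcess.integrableOn_secondMoment {X : ℝ → Ω → E}
    (hX : IsSquareIntegrableProcess P X) (T : ℝ) {Z : Ω → E} (hZ : MemLp Z 2 P) :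
    IntegrableOn (fun s => secondMoment P (X s) Z) (Icc 0 T) :=
  (KuboGLE.secondMoment_integral (hX.memLp_prod T) hZ).1

namespace IsVolterraProcess

variable {Γ : ℝ → E →L[ℝ] E} {g : ℝ} {V₀ : Ω → E} {F V : ℝ → Ω → E}

lemma memLp_rhs (h : IsVolterraProcess P Γ g V₀ F V) {t : ℝ} (ht : 0 ≤ t) :
    MemLp (fun ω => V₀ ω + ∫ s in (0 : ℝ)..t, F s ω) 2 P :=
  h.init.add (h.noise.memLp_integral ht)

/-- The second moments of `V` against a fixed random vector solve a Volterra equation. -/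
lemma secondMoment_equation (h : IsVolterraProcess P Γ g V₀ F V) {t : ℝ} (ht : 0 ≤ t)
    {Z : Ω → E} (hZ : MemLp Z 2 P) :
    secondMoment P (V t) Z + ∫ u in (0 : ℝ)..t, Γ (t - u) * secondMoment P (V u) Z
      = secondMoment P (fun ω => V₀ ω + ∫ s in (0 : ℝ)..t, F s ω) Z := by
  have hW : MemLp (fun p : ℝ × Ω => Γ (t - p.1) (V p.1 p.2)) 2
      ((volume.restrict (Ioc 0 t)).prod P) :=
    memLp_two_clm_process (A := fun s => Γ (t - s)) (h.continuous.comp (by fun_prop))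
      (fun s => h.bound _) (h.solution.memLp_prod_Ioc t)
  have h1 := (memLp_two_integral_prod hW).1
  have h2 := (secondMoment_integral hW hZ).2
  simp only [← intervalIntegral.integral_of_le ht] at h1 h2
  rw [← secondMoment_congr (h.equation t ht) (ae_eq_refl Z),
    secondMoment_add_left (h.solution.memLp t ht) h1 hZ, h2]
  congr 1
  refine intervalIntegral.integral_congr fun u hu => ?_
  rw [uIcc_of_le ht] at hu
  exact (secondMoment_comp_left _ (h.solution.memLp u hu.1) hZ).symm

lemma ae_eq_init (h : IsVolterraProcess P Γ g V₀ F V) : V 0 =ᵐ[P] V₀ := by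
  filter_upwards [h.equation 0 le_rfl] with ω hω
  simpa using hω

/-- The noise is uncorrelated with `V₀`, so the right-hand side stays constant in time. Stationarity
of `V` plays no role, which lets the same `C` serve both directions of the criterion. -/
lemma secondMoment_init (h : IsVolterraProcess P Γ g V₀ F V) {t : ℝ} (ht : 0 ≤ t) :
    secondMoment P (V t) V₀ + ∫ u in (0 : ℝ)..t, Γ (t - u) * secondMoment P (V u) V₀
      = secondMoment P V₀ V₀ := by
  rw [h.secondMoment_equation ht h.init,
    secondMoment_add_left h.init (h.noise.memLp_integral ht) h.init,
    h.noise.secondMoment_integral ht h.init, add_eq_left]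
  refine intervalIntegral.integral_zero_ae (Eventually.of_forall fun u hu => ?_)
  rw [uIoc_of_le ht] at hu
  exact h.uncorrelated u hu.1.le

/-- No mean-square continuity of `V` is needed: the Volterra equation writes this function as a
constant minus a continuous convolution. -/
lemma continuousOn_secondMoment_init (h : IsVolterraProcess P Γ g V₀ F V) :
    ContinuousOn (fun t => secondMoment P (V t) V₀) (Ici 0) := by
  have h1 := continuousOn_volterra_integral h.continuous h.bound h.eq_zero
    (fun T => h.solution.integrableOn_secondMoment T h.init)
  refine (continuousOn_const (c := secondMoment P V₀ V₀).sub h1).congr fun t ht => ?_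
  change _ = secondMoment P V₀ V₀ - ∫ u in (0 : ℝ)..t, Γ (t - u) * secondMoment P (V u) V₀
  rw [← h.secondMoment_init ht, add_sub_cancel_right]

lemma secondMoment_zero_init (h : IsVolterraProcess P Γ g V₀ F V) :
    secondMoment P (V 0) V₀ = secondMoment P V₀ V₀ :=
  secondMoment_congr h.ae_eq_init (ae_eq_refl _)

/-- The second moments of the right-hand side `V₀ + ∫ F` for a second order stationary `F`. -/
lemma secondMoment_rhs (h : IsVolterraProcess P Γ g V₀ F V) {c : ℝ → E →L[ℝ] E}
    (hc : Continuous c) (hcs : ∀ x, star (c x) = c (-x))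
    (hF : ∀ s t, 0 ≤ s → 0 ≤ t → secondMoment P (F t) (F s) = c (t - s)) {s t : ℝ}
    (hs : 0 ≤ s) (ht : 0 ≤ t) :
    secondMoment P (fun ω => V₀ ω + ∫ u in (0 : ℝ)..t, F u ω)
        (fun ω => V₀ ω + ∫ u in (0 : ℝ)..s, F u ω)
      = secondMoment P V₀ V₀ +
        ∫ u in (0 : ℝ)..s, ((∫ x in (0 : ℝ)..(t - u), c x) + star (∫ x in (0 : ℝ)..u, c x)) := by
  have hΦ : ∀ r, 0 ≤ r → MemLp (fun ω => ∫ u in (0 : ℝ)..r, F u ω) 2 P :=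
    fun r hr => h.noise.memLp_integral hr
  have h0 : ∀ r, 0 ≤ r → secondMoment P (fun ω => ∫ u in (0 : ℝ)..r, F u ω) V₀ = 0 :=
    fun r hr => by
    rw [h.noise.secondMoment_integral hr h.init]
    refine intervalIntegral.integral_zero_ae (Eventually.of_forall fun u hu => ?_)
    rw [uIoc_of_le hr] at hu
    exact h.uncorrelated u hu.1.le
  have h0' : secondMoment P V₀ (fun ω => ∫ u in (0 : ℝ)..s, F u ω) = 0 := by
    rw [← star_secondMoment, h0 s hs, star_zero]
  rw [secondMoment_add_left h.init (hΦ t ht) (h.memLp_rhs hs),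
    secondMoment_add_right h.init (hΦ s hs) h.init,
    secondMoment_add_right h.init (hΦ s hs) (hΦ t ht), h0 t ht,
    h0', add_zero, zero_add]
  congr 1
  rw [← star_secondMoment, h.noise.secondMoment_integral hs (hΦ t ht), star_intervalIntegral]
  refine intervalIntegral.integral_congr fun u hu => ?_
  rw [uIcc_of_le hs] at hu
  rw [star_secondMoment, h.noise.secondMoment_integral ht (h.noise.memLp u hu.1)]
  have h1 : ∫ τ in (0 : ℝ)..t, secondMoment P (F τ) (F u) = ∫ τ in (0 : ℝ)..t, c (τ - u) := by
    refine intervalIntegral.integral_congr fun τ hτ => ?_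
    rw [uIcc_of_le ht] at hτ
    exact hF u τ hu.1 hτ.1
  -- The integral of `c` over `[-u, t - u]` is split at 0; by `c (-x) = star (c x)` the negative
  -- part is the adjoint of the primitive at `u`.
  have hii : ∀ a b, IntervalIntegrable c volume a b := fun a b => hc.intervalIntegrable a b
  rw [h1, intervalIntegral.integral_comp_sub_right (fun x => c x), zero_sub,
    ← intervalIntegral.integral_add_adjacent_intervals (hii (-u) 0) (hii 0 (t - u)), add_comm,
    star_intervalIntegral]
  congr 1
  simp only [hcs]
  rw [intervalIntegral.integral_comp_neg (fun x => c x), neg_zero]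

/-- The second order stationarity of `V` is equivalent to an identity between the primitives of
the autocovariance `c` of the noise and of the memory kernel. -/
theorem stationary_iff (h : IsVolterraProcess P Γ g V₀ F V) {c : ℝ → E →L[ℝ] E}
    (hc : Continuous c) (hcs : ∀ x, star (c x) = c (-x))
    (hF : ∀ s t, 0 ≤ s → 0 ≤ t → secondMoment P (F t) (F s) = c (t - s)) :
    (∀ s t, 0 ≤ s → 0 ≤ t → secondMoment P (V (s + t)) (V s) = secondMoment P (V t) (V 0)) ↔
      ∀ x, 0 ≤ x → ∫ u in (0 : ℝ)..x, c u = Γ x * secondMoment P V₀ V₀ := by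
  set S := secondMoment P V₀ V₀ with hSdef
  have hS : star S = S := star_secondMoment _ _
  set C := hermitianExtension (fun t => secondMoment P (V t) V₀) with hCdef
  have hC0 : star (secondMoment P (V 0) V₀) = secondMoment P (V 0) V₀ := by
    rw [h.secondMoment_zero_init, hS]
  have hCc : Continuous C := continuous_hermitianExtension h.continuousOn_secondMoment_init hC0
  have hCs : ∀ x, star (C x) = C (-x) :=
    star_hermitianExtension (f := fun t => secondMoment P (V t) V₀) hC0
  have hCn : ∀ t, 0 ≤ t → C t = secondMoment P (V t) V₀ := fun t ht =>
    hermitianExtension_of_nonneg ht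
  have hCV : ∀ t, 0 ≤ t → C t + ∫ u in (0 : ℝ)..t, Γ (t - u) * C u = S := fun t ht => by
    rw [hSdef, ← h.secondMoment_init ht, hCn t ht]
    congr 1
    refine intervalIntegral.integral_congr fun u hu => ?_
    rw [uIcc_of_le ht] at hu
    simp only [hCn u hu.1]
  have hGc : Continuous fun x => ∫ u in (0 : ℝ)..x, c u :=
    intervalIntegral.continuous_primitive (fun a b => hc.intervalIntegrable a b) 0
  set G : ℝ → E →L[ℝ] E := fun x => ∫ u in (0 : ℝ)..x, c u with hG
  have hV0 : ∀ t, secondMoment P (V t) (V 0) = secondMoment P (V t) V₀ := fun t =>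
    secondMoment_congr (ae_eq_refl _) h.ae_eq_init
  have hΓ := h.continuous
  constructor
  · intro hstat
    have hCst : ∀ s t, 0 ≤ s → 0 ≤ t → secondMoment P (V t) (V s) = C (t - s) := by
      have key : ∀ s t, 0 ≤ s → s ≤ t → secondMoment P (V t) (V s) = C (t - s) :=
        fun s t hs hst => by
        have := hstat s (t - s) hs (by linarith)
        rw [add_sub_cancel] at this
        rw [this, hV0, hCn _ (by linarith)]
      intro s t hs ht
      rcases le_total s t with hst | hst
      · exact key s t hs hst
      · rw [← star_secondMoment, key t s ht hst, hCs, neg_sub]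
    have hYV : ∀ s t, 0 ≤ s → 0 ≤ t →
        secondMoment P (fun ω => V₀ ω + ∫ u in (0 : ℝ)..t, F u ω) (V s)
          = leftVolterra Γ C t s := fun s t hs ht => by
      rw [← h.secondMoment_equation ht (h.solution.memLp s hs), hCst s t hs ht]
      unfold leftVolterra
      congr 1
      refine intervalIntegral.integral_congr fun u hu => ?_
      rw [uIcc_of_le ht] at hu
      simp only [hCst s u hs hu.1]
    have hYY : ∀ s t, 0 ≤ s → 0 ≤ t →
        secondMoment P (fun ω => V₀ ω + ∫ u in (0 : ℝ)..t, F u ω)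
          (fun ω => V₀ ω + ∫ u in (0 : ℝ)..s, F u ω) = biVolterra Γ C t s := fun s t hs ht => by
      rw [← star_secondMoment, ← h.secondMoment_equation hs (h.memLp_rhs ht), star_add,
        star_intervalIntegral, star_secondMoment, hYV s t hs ht]
      unfold biVolterra
      congr 1
      refine intervalIntegral.integral_congr fun u hu => ?_
      rw [uIcc_of_le hs] at hu
      simp only [star_mul, star_secondMoment, hYV u t hu.1 ht]
    -- Comparing the two formulas for the second moments of `Y` gives the integral condition on `D`;
    -- `D 0 = 0` because `Γ 0 = 0`.
    have hD := eq_zero_of_integral_add_star_eq_zero (D := fun x => G x - Γ x * S)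
      (by fun_prop) (by simp [hG, h.eq_zero 0 le_rfl]) ?_
    · exact fun x hx => sub_eq_zero.1 (hD x hx)
    intro s t hs hst
    have h1 := hYY s t hs (hs.trans hst)
    rw [h.secondMoment_rhs hc hcs hF hs (hs.trans hst),
      biVolterra_eq_of_le hΓ hCc hCV hS hCs hs hst, add_right_inj] at h1
    rw [← sub_eq_zero, ← intervalIntegral.integral_sub
      (Continuous.intervalIntegrable (by fun_prop) _ _)
      (Continuous.intervalIntegrable (by fun_prop) _ _)] at h1
    rw [← h1]
    refine intervalIntegral.integral_congr fun u _ => ?_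
    simp only [star_sub, star_mul, hS, hG]
    abel
  · intro hG'
    have hYY : ∀ s t, 0 ≤ s → 0 ≤ t →
        secondMoment P (fun ω => V₀ ω + ∫ u in (0 : ℝ)..t, F u ω)
          (fun ω => V₀ ω + ∫ u in (0 : ℝ)..s, F u ω) = biVolterra Γ C t s := by
      have key : ∀ s t, 0 ≤ s → s ≤ t →
          secondMoment P (fun ω => V₀ ω + ∫ u in (0 : ℝ)..t, F u ω)
            (fun ω => V₀ ω + ∫ u in (0 : ℝ)..s, F u ω) = biVolterra Γ C t s :=
        fun s t hs hst => by
        rw [h.secondMoment_rhs hc hcs hF hs (hs.trans hst),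
          biVolterra_eq_of_le hΓ hCc hCV hS hCs hs hst, add_right_inj]
        refine intervalIntegral.integral_congr fun u hu => ?_
        rw [uIcc_of_le hs] at hu
        rw [hG' _ (by linarith [hu.2]), hG' _ hu.1, star_mul, hS]
      intro s t hs ht
      rcases le_total s t with hst | hst
      · exact key s t hs hst
      · rw [← star_secondMoment, key t s ht hst, star_biVolterra hΓ hCc hCs]
    -- First inversion: with the time in `Y` fixed, both sides solve the adjoint of the equation
    -- defining `biVolterra`.
    have hVY : ∀ t, 0 ≤ t → ∀ s, 0 ≤ s →
        secondMoment P (V s) (fun ω => V₀ ω + ∫ u in (0 : ℝ)..t, F u ω)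
          = star (leftVolterra Γ C t s) := by
      intro t ht s hs
      refine volterra_unique (T := s) hΓ h.bound
        (h.solution.integrableOn_secondMoment s (h.memLp_rhs ht))
        (continuous_leftVolterra hΓ hCc t).star.integrableOn_Icc (fun r hr => ?_) s ⟨hs, le_rfl⟩
      rw [h.secondMoment_equation hr.1 (h.memLp_rhs ht), ← star_secondMoment, hYY r t hr.1 ht]
      unfold biVolterra
      rw [star_add, star_intervalIntegral]
      simp only [star_mul, star_star]
    -- Second inversion, in the other variable: `C (t - s)` solves the equation by the very
    -- definition of `leftVolterra`.
    have hVV : ∀ s, 0 ≤ s → ∀ t, 0 ≤ t → secondMoment P (V t) (V s) = C (t - s) := by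
      intro s hs t ht
      refine volterra_unique (T := t) (q := fun t => C (t - s)) hΓ h.bound
        (h.solution.integrableOn_secondMoment t (h.solution.memLp s hs))
        (Continuous.integrableOn_Icc (by fun_prop)) (fun r hr => ?_) t ⟨ht, le_rfl⟩
      rw [h.secondMoment_equation hr.1 (h.solution.memLp s hs), ← star_secondMoment,
        hVY r hr.1 s hs, star_star]
      rfl
    intro s t hs ht
    rw [hVV s hs (s + t) (by linarith), hVV 0 le_rfl t ht, add_sub_cancel_left, sub_zero]

/-- The mean of `V` vanishes if `V₀` and `F` are centred. -/
lemma integral_eq_zero (h : IsVolterraProcess P Γ g V₀ F V) (h0 : ∫ ω, V₀ ω ∂P = 0)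
    (hF : ∀ t, 0 ≤ t → ∫ ω, F t ω ∂P = 0) {t : ℝ} (ht : 0 ≤ t) : ∫ ω, V t ω ∂P = 0 := by
  -- The mean is paired with itself: the resulting rank one operator vanishes only if `c = 0`.
  set c := ∫ ω, V t ω ∂P with hcdef
  have hc : MemLp (fun _ : Ω => c) 2 P := memLp_const c
  have h1 : secondMoment P (V t) (fun _ => c) = 0 := by
    refine volterra_unique (T := t) (q := fun _ => 0) h.continuous h.bound
      (h.solution.integrableOn_secondMoment t hc) continuous_const.integrableOn_Icc (fun r hr => ?_) t ⟨ht, le_rfl⟩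
    rw [h.secondMoment_equation hr.1 hc,
      secondMoment_add_left h.init (h.noise.memLp_integral hr.1) hc,
      h.noise.secondMoment_integral hr.1 hc, secondMoment_const_right h.init, h0]
    simp only [map_zero, _root_.zero_apply, mul_zero,
      intervalIntegral.integral_zero, zero_add]
    refine intervalIntegral.integral_zero_ae (Eventually.of_forall fun u hu => ?_)
    rw [uIoc_of_le hr.1] at hu
    rw [secondMoment_const_right (h.noise.memLp u hu.1.le), hF u hu.1.le]
    simp
  rw [secondMoment_const_right (h.solution.memLp t ht), ← hcdef] at h1
  simpa using h1

end IsVolterraProcess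

end VolterraProcess

/-! ### Passage between matrices and operators on Euclidean space -/

section Matrices

variable {d : ℕ}

lemma toEuclideanCLM_eq_sum (M : Matrix (Fin d) (Fin d) ℝ) :
    Matrix.toEuclideanCLM (n := Fin d) (𝕜 := ℝ) M
      = ∑ i, ∑ j, M i j • Matrix.toEuclideanCLM (n := Fin d) (𝕜 := ℝ) (Matrix.single i j 1) := by
  conv_lhs => rw [Matrix.matrix_eq_sum_single M]
  simp only [map_sum]
  refine Finset.sum_congr rfl fun i _ => Finset.sum_congr rfl fun j _ => ?_
  rw [← map_smul]
  simp

/-- With fixed operators as coefficients of the entries, entrywise integrability, continuity and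
derivatives transfer to operators through finite sums, without choosing a norm on matrices. -/
lemma exists_toEuclideanCLM_eq_sum (d : ℕ) :
    ∃ B : Fin d → Fin d → EuclideanSpace ℝ (Fin d) →L[ℝ] EuclideanSpace ℝ (Fin d),
      ∀ M : Matrix (Fin d) (Fin d) ℝ,
        Matrix.toEuclideanCLM (n := Fin d) (𝕜 := ℝ) M = ∑ i, ∑ j, M i j • B i j :=
  ⟨_, toEuclideanCLM_eq_sum⟩

lemma integrable_sum_smul {α ι G : Type*} [Fintype ι] [MeasurableSpace α] {μ : Measure α}
    [NormedAddCommGroup G] [NormedSpace ℝ G] (B : ι → ι → G) {M : α → Matrix ι ι ℝ}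
    (hM : ∀ i j, Integrable (fun a => M a i j) μ) :
    Integrable (fun a => ∑ i, ∑ j, M a i j • B i j) μ :=
  integrable_finsetSum _ fun i _ => integrable_finsetSum _ fun j _ => (hM i j).smul_const _

lemma integral_sum_smul {α ι G : Type*} [Fintype ι] [MeasurableSpace α] {μ : Measure α}
    [NormedAddCommGroup G] [NormedSpace ℝ G] [CompleteSpace G] (B : ι → ι → G)
    {M : α → Matrix ι ι ℝ} (hM : ∀ i j, Integrable (fun a => M a i j) μ) :
    ∫ a, ∑ i, ∑ j, M a i j • B i j ∂μ = ∑ i, ∑ j, (∫ a, M a i j ∂μ) • B i j := by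
  rw [integral_finsetSum _ fun i _ => integrable_finsetSum _ fun j _ => (hM i j).smul_const _]
  refine Finset.sum_congr rfl fun i _ => ?_
  rw [integral_finsetSum _ fun j _ => (hM i j).smul_const _]
  exact Finset.sum_congr rfl fun j _ => integral_smul_const _ _

lemma integrable_toEuclideanCLM {α : Type*} [MeasurableSpace α] {μ : Measure α}
    {M : α → Matrix (Fin d) (Fin d) ℝ} (hM : ∀ i j, Integrable (fun a => M a i j) μ) :
    Integrable (fun a => Matrix.toEuclideanCLM (n := Fin d) (𝕜 := ℝ) (M a)) μ := by
  obtain ⟨B, hB⟩ := exists_toEuclideanCLM_eq_sum d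
  simpa only [hB] using integrable_sum_smul B hM

lemma integral_toEuclideanCLM {α : Type*} [MeasurableSpace α] {μ : Measure α}
    {M : α → Matrix (Fin d) (Fin d) ℝ} (hM : ∀ i j, Integrable (fun a => M a i j) μ) :
    ∫ a, Matrix.toEuclideanCLM (n := Fin d) (𝕜 := ℝ) (M a) ∂μ
      = Matrix.toEuclideanCLM (n := Fin d) (𝕜 := ℝ) (Matrix.of fun i j => ∫ a, M a i j ∂μ) := by
  obtain ⟨B, hB⟩ := exists_toEuclideanCLM_eq_sum d
  simpa only [hB, Matrix.of_apply] using integral_sum_smul B hM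

lemma rankOne_eq_toEuclideanCLM (x y : EuclideanSpace ℝ (Fin d)) :
    InnerProductSpace.rankOne ℝ x y
      = Matrix.toEuclideanCLM (n := Fin d) (𝕜 := ℝ) (Matrix.of fun i j => x i * y j) := by
  ext z i
  simp [Matrix.mulVec, dotProduct, PiLp.inner_apply, Finset.sum_mul]
  refine Finset.sum_congr rfl fun j _ => ?_
  ring

variable {Ω : Type*} [MeasurableSpace Ω] {P : Measure Ω}

lemma integrable_entries {X Y : Ω → EuclideanSpace ℝ (Fin d)} (hX : MemLp X 2 P)
    (hY : MemLp Y 2 P) (i j : Fin d) : Integrable (fun ω => X ω i * Y ω j) P :=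
  (hX.eval_piLp i).integrable_mul (hY.eval_piLp j)

lemma secondMoment_eq_toEuclideanCLM {X Y : Ω → EuclideanSpace ℝ (Fin d)} (hX : MemLp X 2 P)
    (hY : MemLp Y 2 P) :
    secondMoment P X Y = Matrix.toEuclideanCLM (n := Fin d) (𝕜 := ℝ) (crossMoment P X Y) := by
  unfold secondMoment crossMoment
  simp only [rankOne_eq_toEuclideanCLM]
  exact integral_toEuclideanCLM fun i j => integrable_entries hX hY i j

lemma integral_sq_norm_eq_trace {X : Ω → EuclideanSpace ℝ (Fin d)} (hX : MemLp X 2 P) :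
    ∫ ω, ‖X ω‖ ^ 2 ∂P = (crossMoment P X X).trace := by
  simp only [EuclideanSpace.norm_sq_eq, Matrix.trace, crossMoment, Matrix.diag, Matrix.of_apply]
  rw [integral_finsetSum]
  · simp [sq]
  · intro i _
    simpa [sq] using integrable_entries hX hX i i

end Matrices

/-! ### Moments of the initial value and of the noise -/

section Data

variable {Ω : Type*} [MeasurableSpace Ω] {P : Measure Ω} {d : ℕ}

lemma memLp_of_hasLaw_gaussian {S : Matrix (Fin d) (Fin d) ℝ} {V₀ : Ω → EuclideanSpace ℝ (Fin d)}
    (hV₀ : HasLaw V₀ (multivariateGaussian 0 S) P) : MemLp V₀ 2 P := by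
  have h := IsGaussian.memLp_two_id (μ := multivariateGaussian (0 : EuclideanSpace ℝ (Fin d)) S)
  rw [← hV₀.map_eq] at h
  exact (memLp_map_measure_iff aestronglyMeasurable_id hV₀.aemeasurable).1 h

lemma integral_of_hasLaw_gaussian {S : Matrix (Fin d) (Fin d) ℝ}
    {V₀ : Ω → EuclideanSpace ℝ (Fin d)} (hV₀ : HasLaw V₀ (multivariateGaussian 0 S) P) :
    ∫ ω, V₀ ω ∂P = 0 := by
  rw [hV₀.integral_eq]
  simp

lemma integral_apply_of_hasLaw_gaussian {S : Matrix (Fin d) (Fin d) ℝ}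
    {V₀ : Ω → EuclideanSpace ℝ (Fin d)} (hV₀ : HasLaw V₀ (multivariateGaussian 0 S) P)
    [IsFiniteMeasure P] (i : Fin d) : ∫ ω, V₀ ω i ∂P = 0 := by
  have h := ((memLp_of_hasLaw_gaussian hV₀).integrable (by norm_num)).eval_piLp
  rw [← eval_integral_piLp h, integral_of_hasLaw_gaussian hV₀]
  simp

lemma crossMoment_of_hasLaw_gaussian [IsProbabilityMeasure P] {S : Matrix (Fin d) (Fin d) ℝ} (hS : S.PosSemidef)
    {V₀ : Ω → EuclideanSpace ℝ (Fin d)} (hV₀ : HasLaw V₀ (multivariateGaussian 0 S) P) :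
    crossMoment P V₀ V₀ = S := by
  ext i j
  have h2 := (memLp_of_hasLaw_gaussian hV₀).eval_piLp
  have h := hV₀.covariance_fun_comp (f := fun x => x i) (g := fun x => x j)
    (by fun_prop) (by fun_prop)
  rw [covariance_eval_multivariateGaussian hS, covariance_eq_sub (h2 i) (h2 j),
    integral_apply_of_hasLaw_gaussian hV₀, zero_mul, sub_zero] at h
  exact h

lemma crossMoment_eq_zero_of_indepFun {T : Type*} {V₀ : Ω → EuclideanSpace ℝ (Fin d)}
    {F : T → Ω → EuclideanSpace ℝ (Fin d)} (hind : IndepFun V₀ (fun ω t => F t ω) P)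
    (hV₀ : AEStronglyMeasurable V₀ P) (h0 : ∀ i, ∫ ω, V₀ ω i ∂P = 0) {t : T}
    (hF : AEStronglyMeasurable (F t) P) : crossMoment P (F t) V₀ = 0 := by
  ext i j
  have h1 : IndepFun (fun ω => V₀ ω j) (fun ω => F t ω i) P :=
    hind.comp (φ := fun x : EuclideanSpace ℝ (Fin d) => x j)
      (ψ := fun f : T → EuclideanSpace ℝ (Fin d) => f t i) (by fun_prop) (by fun_prop)
  have h2 := h1.integral_fun_mul_eq_mul_integral
    ((EuclideanSpace.proj (𝕜 := ℝ) j).continuous.comp_aestronglyMeasurable hV₀)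
    ((EuclideanSpace.proj (𝕜 := ℝ) i).continuous.comp_aestronglyMeasurable hF)
  simp only [crossMoment, Matrix.of_apply, Matrix.zero_apply]
  simp only [mul_comm (F t _ i)]
  rw [h2, h0, zero_mul]

variable {F : ℝ → Ω → EuclideanSpace ℝ (Fin d)}

lemma IsMeasurableProcess.mono [SFinite P] {X : ℝ → Ω → EuclideanSpace ℝ (Fin d)}
    (hX : IsMeasurableProcess P X) (T : ℝ) :
    AEStronglyMeasurable (fun p : ℝ × Ω => X p.1 p.2) ((volume.restrict (Icc 0 T)).prod P) :=
  hX.mono_measure (Measure.prod_mono (Measure.restrict_mono (fun _ h => h.1) le_rfl) le_rfl)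

/-- The mean square is the trace of the second moment at lag zero, which is constant in time by
stationarity; this bounds it uniformly. -/
lemma IsStationary.isSquareIntegrableProcess [IsFiniteMeasure P] (hF : IsStationary P F)
    (hm : IsMeasurableProcess P F) : IsSquareIntegrableProcess P F where
  memLp := hF.memLp
  memLp_prod T := by
    refine memLp_two_prod (K := (crossMoment P (F 0) (F 0)).trace) (hm.mono T)
      (ae_restrict_of_forall_mem measurableSet_Icc fun s hs => hF.memLp s hs.1)
      (ae_restrict_of_forall_mem measurableSet_Icc fun s hs => ?_)
    rw [integral_sq_norm_eq_trace (hF.memLp s hs.1)]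
    have := hF.shift s 0 hs.1 le_rfl
    rw [add_zero] at this
    rw [this]

/-- Mean-square continuity makes second moments continuous in time. -/
lemma IsMeanSquareContinuous.continuousOn_secondMoment (hF : IsMeanSquareContinuous P F)
    (h2 : ∀ t, 0 ≤ t → MemLp (F t) 2 P) {Z : Ω → EuclideanSpace ℝ (Fin d)} (hZ : MemLp Z 2 P) :
    ContinuousOn (fun t => secondMoment P (F t) Z) (Ici 0) := by
  intro t ht
  rw [ContinuousWithinAt, tendsto_iff_edist_tendsto_0]
  have h1 : Tendsto (fun u => eLpNorm (F u - F t) 2 P * eLpNorm Z 2 P) (𝓝[Ici 0] t) (𝓝 0) := by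
    have := ENNReal.Tendsto.mul_const (hF t ht) (b := eLpNorm Z 2 P) (Or.inr hZ.2.ne)
    rwa [zero_mul] at this
  refine tendsto_of_tendsto_of_tendsto_of_le_of_le' tendsto_const_nhds h1
    (Eventually.of_forall fun _ => zero_le) ?_
  filter_upwards [self_mem_nhdsWithin] with u hu
  rw [edist_eq_enorm_sub, ← secondMoment_sub_left (h2 u hu) (h2 t ht) hZ]
  exact enorm_secondMoment_le ((h2 u hu).1.sub (h2 t ht).1) hZ.1

end Data

/-! ### The memory kernel and its primitive -/

section Kernel

variable {d : ℕ} {γ : ℝ → Matrix (Fin d) (Fin d) ℝ}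

/-- The memory kernel as an operator valued function, extended by zero to negative times. -/
noncomputable def kernelCLM (γ : ℝ → Matrix (Fin d) (Fin d) ℝ) (t : ℝ) :
    EuclideanSpace ℝ (Fin d) →L[ℝ] EuclideanSpace ℝ (Fin d) :=
  (Ioi 0).indicator (fun t => Matrix.toEuclideanCLM (n := Fin d) (𝕜 := ℝ) (γ t)) t

lemma kernelCLM_of_pos {t : ℝ} (ht : 0 < t) :
    kernelCLM γ t = Matrix.toEuclideanCLM (n := Fin d) (𝕜 := ℝ) (γ t) :=
  indicator_of_mem (show t ∈ Ioi 0 from ht) _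

lemma integrable_kernelCLM (hγ : ∀ i j, IntegrableOn (fun t => γ t i j) (Ioi 0)) :
    Integrable (kernelCLM γ) := by
  have h : IntegrableOn (fun t => Matrix.toEuclideanCLM (n := Fin d) (𝕜 := ℝ) (γ t)) (Ioi 0) :=
    integrable_toEuclideanCLM hγ
  exact (integrable_indicator_iff (ε' := EuclideanSpace ℝ (Fin d) →L[ℝ] EuclideanSpace ℝ (Fin d))
    measurableSet_Ioi).2 h

lemma continuous_integral_kernelCLM (hγ : ∀ i j, IntegrableOn (fun t => γ t i j) (Ioi 0)) :
    Continuous fun x => ∫ t in (0 : ℝ)..x, kernelCLM γ t :=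
  intervalIntegral.continuous_primitive
    (fun _ _ => (integrable_kernelCLM hγ).intervalIntegrable) 0

lemma norm_integral_kernelCLM_le (hγ : ∀ i j, IntegrableOn (fun t => γ t i j) (Ioi 0)) (x : ℝ) :
    ‖∫ t in (0 : ℝ)..x, kernelCLM γ t‖ ≤ ∫ t, ‖kernelCLM γ t‖ := by
  refine intervalIntegral.norm_integral_le_integral_norm_uIoc.trans ?_
  exact setIntegral_le_integral (integrable_kernelCLM hγ).norm
    (Eventually.of_forall fun _ => norm_nonneg _)

lemma integral_kernelCLM_of_nonpos {x : ℝ} (hx : x ≤ 0) :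
    ∫ t in (0 : ℝ)..x, kernelCLM γ t = 0 := by
  refine intervalIntegral.integral_zero_ae (Eventually.of_forall fun t ht => ?_)
  rw [uIoc_of_ge hx] at ht
  exact indicator_of_notMem (by simpa using ht.2) _

end Kernel

/-! ### The differential resolvent as a solution of a Volterra equation -/

section Resolvent

lemma integral_convolution_mul_eq {A : Type*} [NormedRing A] [NormedAlgebra ℝ A] [CompleteSpace A]
    {k v : ℝ → A} {t : ℝ} (ht : 0 ≤ t) (hk : Integrable k) (hv : IntegrableOn v (Icc 0 t)) :
    ∫ τ in (0 : ℝ)..t, ∫ s in (0 : ℝ)..τ, k (τ - s) * v s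
      = ∫ s in (0 : ℝ)..t, (∫ x in (0 : ℝ)..(t - s), k x) * v s :=
  integral_convolution_eq (ContinuousLinearMap.mul ℝ A) ht hk hv

lemma intervalIntegrable_convolution_mul {A : Type*} [NormedRing A] [NormedAlgebra ℝ A]
    {k v : ℝ → A} {t : ℝ} (ht : 0 ≤ t) (hk : Integrable k) (hv : IntegrableOn v (Icc 0 t)) :
    IntervalIntegrable (fun τ => ∫ s in (0 : ℝ)..τ, k (τ - s) * v s) volume 0 t :=
  intervalIntegrable_convolution (ContinuousLinearMap.mul ℝ A) ht hk hv

lemma toEuclideanCLM_inj {d : ℕ} {M N : Matrix (Fin d) (Fin d) ℝ} :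
    Matrix.toEuclideanCLM (n := Fin d) (𝕜 := ℝ) M = Matrix.toEuclideanCLM (n := Fin d) (𝕜 := ℝ) N
      ↔ M = N :=
  EmbeddingLike.apply_eq_iff_eq _

variable {d : ℕ} {γ : ℝ → Matrix (Fin d) (Fin d) ℝ}

/-- Only `s = τ` is exceptional: there `kernelCLM` is zero, whereas `γ 0` is arbitrary. -/
lemma ae_kernelCLM_eq (τ : ℝ) : ∀ᵐ s : ℝ, s ∈ uIoc 0 τ → 0 ≤ τ →
    kernelCLM γ (τ - s) = Matrix.toEuclideanCLM (n := Fin d) (𝕜 := ℝ) (γ (τ - s)) := by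
  have h : ∀ᵐ s : ℝ, s ≠ τ := by simp [ae_iff]
  filter_upwards [h] with s hs hs' hτ
  rw [uIoc_of_le hτ] at hs'
  exact kernelCLM_of_pos (sub_pos.2 (lt_of_le_of_ne hs'.2 hs))

lemma integral_toEuclideanCLM_mul (hγ : ∀ i j, IntegrableOn (fun t => γ t i j) (Ioi 0))
    {r : ℝ → Matrix (Fin d) (Fin d) ℝ} (hr : ∀ i j, ContinuousOn (fun t => r t i j) (Ici 0))
    {t : ℝ} (ht : 0 ≤ t) :
    ∫ s in (0 : ℝ)..t,
        kernelCLM γ (t - s) * Matrix.toEuclideanCLM (n := Fin d) (𝕜 := ℝ) (r s)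
      = Matrix.toEuclideanCLM (n := Fin d) (𝕜 := ℝ)
          (Matrix.of fun i j => ∫ s in (0 : ℝ)..t, (γ (t - s) * r s) i j) := by
  have h1 : ∀ i j, IntegrableOn (fun s => (γ (t - s) * r s) i j) (Ioc 0 t) := by
    intro i j
    simp only [Matrix.mul_apply]
    refine integrable_finsetSum _ fun l _ => ?_
    have h2 : IntervalIntegrable (fun s => γ s i l) volume 0 t := by
      rw [intervalIntegrable_iff_integrableOn_Ioc_of_le ht]
      exact (hγ i l).mono_set fun x hx => hx.1
    have h3 : IntervalIntegrable (fun s => γ (t - s) i l) volume 0 t := by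
      have := (h2.comp_sub_left t).symm
      simpa using this
    refine (intervalIntegrable_iff_integrableOn_Ioc_of_le ht).1
      (h3.mul_continuousOn ((hr l j).mono ?_))
    rw [uIcc_of_le ht]
    exact fun x hx => hx.1
  have h4 : ∫ s in (0 : ℝ)..t,
        kernelCLM γ (t - s) * Matrix.toEuclideanCLM (n := Fin d) (𝕜 := ℝ) (r s)
      = ∫ s in (0 : ℝ)..t, Matrix.toEuclideanCLM (n := Fin d) (𝕜 := ℝ) (γ (t - s) * r s) := by
    refine intervalIntegral.integral_congr_ae ?_
    filter_upwards [ae_kernelCLM_eq (γ := γ) t] with s hs hs'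
    rw [hs hs' ht, map_mul]
  rw [h4]
  simp only [intervalIntegral.integral_of_le ht]
  exact integral_toEuclideanCLM h1

lemma continuousOn_sum_smul {ι G : Type*} [Fintype ι] [NormedAddCommGroup G] [NormedSpace ℝ G]
    (B : ι → ι → G) {r : ℝ → Matrix ι ι ℝ} {s : Set ℝ}
    (hr : ∀ i j, ContinuousOn (fun t => r t i j) s) :
    ContinuousOn (fun t => ∑ i, ∑ j, r t i j • B i j) s :=
  continuousOn_finsetSum _ fun i _ => continuousOn_finsetSum _ fun j _ =>
    (hr i j).smul continuousOn_const

lemma hasDerivWithinAt_sum_smul {ι G : Type*} [Fintype ι] [NormedAddCommGroup G]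
    [NormedSpace ℝ G] (B : ι → ι → G) {r : ℝ → Matrix ι ι ℝ} {r' : Matrix ι ι ℝ} {s : Set ℝ}
    {t : ℝ} (hr : ∀ i j, HasDerivWithinAt (fun t => r t i j) (r' i j) s t) :
    HasDerivWithinAt (fun t => ∑ i, ∑ j, r t i j • B i j) (∑ i, ∑ j, r' i j • B i j) s t :=
  HasDerivWithinAt.fun_sum fun i _ => HasDerivWithinAt.fun_sum fun j _ => (hr i j).smul_const _

namespace IsDifferentialResolvent

variable {r : ℝ → Matrix (Fin d) (Fin d) ℝ}

lemma continuousOn_toEuclideanCLM (hr : IsDifferentialResolvent γ r) :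
    ContinuousOn (fun t => Matrix.toEuclideanCLM (n := Fin d) (𝕜 := ℝ) (r t)) (Ici 0) := by
  obtain ⟨B, hB⟩ := exists_toEuclideanCLM_eq_sum d
  simp only [hB]
  exact continuousOn_sum_smul B fun i j t ht => (hr.deriv t ht i j).continuousWithinAt

lemma hasDerivWithinAt_toEuclideanCLM (hr : IsDifferentialResolvent γ r)
    (hγ : ∀ i j, IntegrableOn (fun t => γ t i j) (Ioi 0)) {t : ℝ} (ht : 0 ≤ t) :
    HasDerivWithinAt (fun t => Matrix.toEuclideanCLM (n := Fin d) (𝕜 := ℝ) (r t))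
      (- ∫ s in (0 : ℝ)..t,
        kernelCLM γ (t - s) * Matrix.toEuclideanCLM (n := Fin d) (𝕜 := ℝ) (r s)) (Ici 0) t := by
  rw [integral_toEuclideanCLM_mul hγ
    (fun i j t ht => (hr.deriv t ht i j).continuousWithinAt) ht, ← map_neg]
  obtain ⟨B, hB⟩ := exists_toEuclideanCLM_eq_sum d
  simp only [hB]
  exact hasDerivWithinAt_sum_smul B fun i j => by simpa using hr.deriv t ht i j

/-- The integrated form of the resolvent equation. -/
lemma volterra_equation (hr : IsDifferentialResolvent γ r)
    (hγ : ∀ i j, IntegrableOn (fun t => γ t i j) (Ioi 0)) {t : ℝ} (ht : 0 ≤ t) :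
    Matrix.toEuclideanCLM (n := Fin d) (𝕜 := ℝ) (r t)
      + ∫ u in (0 : ℝ)..t, (∫ x in (0 : ℝ)..(t - u), kernelCLM γ x)
        * Matrix.toEuclideanCLM (n := Fin d) (𝕜 := ℝ) (r u) = 1 := by
  have hc : ContinuousOn (fun t => Matrix.toEuclideanCLM (n := Fin d) (𝕜 := ℝ) (r t)) (Icc 0 t) :=
    hr.continuousOn_toEuclideanCLM.mono fun x hx => hx.1
  have hi := hc.integrableOn_Icc (μ := volume)
  have h1 := integral_convolution_mul_eq ht (integrable_kernelCLM hγ) hi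
  have h2 := intervalIntegrable_convolution_mul ht (integrable_kernelCLM hγ) hi
  have h3 := intervalIntegral.integral_eq_sub_of_hasDeriv_right_of_le ht hc
    (fun x hx => (hr.hasDerivWithinAt_toEuclideanCLM hγ hx.1.le).mono
      fun y hy => hx.1.le.trans (le_of_lt hy)) h2.neg
  rw [hr.init, map_one, intervalIntegral.integral_neg, h1] at h3
  rw [← sub_eq_zero, ← neg_eq_zero, ← sub_eq_zero.2 h3]
  abel

end IsDifferentialResolvent

end Resolvent

/-! ### From strong solutions to the stationarity criterion -/

section Main

variable {Ω : Type*} [MeasurableSpace Ω] {P : Measure Ω}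
  {d : ℕ} {γ : ℝ → Matrix (Fin d) (Fin d) ℝ} {V₀ : Ω → EuclideanSpace ℝ (Fin d)}
  {F V : ℝ → Ω → EuclideanSpace ℝ (Fin d)}

/-- A strong solution satisfies a Volterra equation whose kernel is the primitive of `γ`. -/
lemma IsStrongSolution.volterra_equation (hV : IsStrongSolution P γ V₀ F V)
    (hγ : ∀ i j, IntegrableOn (fun t => γ t i j) (Ioi 0)) {t : ℝ} (ht : 0 ≤ t) :
    ∀ᵐ ω ∂P, V t ω + ∫ s in (0 : ℝ)..t, (∫ x in (0 : ℝ)..(t - s), kernelCLM γ x) (V s ω)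
      = V₀ ω + ∫ s in (0 : ℝ)..t, F s ω := by
  filter_upwards [hV.integrated t ht, hV.integrable] with ω h1 h2
  have h3 := integral_convolution_eq
    (ContinuousLinearMap.id ℝ (EuclideanSpace ℝ (Fin d) →L[ℝ] EuclideanSpace ℝ (Fin d)))
    ht (integrable_kernelCLM hγ) (h2 t)
  simp only [ContinuousLinearMap.id_apply] at h3
  have h4 : ∫ τ in (0 : ℝ)..t, ∫ s in (0 : ℝ)..τ,
        Matrix.toEuclideanCLM (n := Fin d) (𝕜 := ℝ) (γ (τ - s)) (V s ω)
      = ∫ τ in (0 : ℝ)..t, ∫ s in (0 : ℝ)..τ, kernelCLM γ (τ - s) (V s ω) := by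
    refine intervalIntegral.integral_congr fun τ hτ => ?_
    rw [uIcc_of_le ht] at hτ
    refine intervalIntegral.integral_congr_ae ?_
    filter_upwards [ae_kernelCLM_eq (γ := γ) τ] with s hs hs'
    rw [hs hs' hτ.1]
  rw [← h3, ← h4, h1]
  abel

lemma IsSquareIntegrableProcess.exists_integral_sq_norm_le [IsFiniteMeasure P]
    (hF : IsSquareIntegrableProcess P F) (hV₀ : MemLp V₀ 2 P) (T : ℝ) :
    ∃ K, ∀ t ∈ Icc 0 T, ∫ ω, ‖V₀ ω + ∫ s in (0 : ℝ)..t, F s ω‖ ^ 2 ∂P ≤ K := by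
  refine ⟨2 * ∫ ω, ‖V₀ ω‖ ^ 2 ∂P + 2 * (T * ∫ s in Icc 0 T, ∫ ω, ‖F s ω‖ ^ 2 ∂P),
    fun t ht => ?_⟩
  obtain ⟨h1, h2⟩ := memLp_two_integral_prod (hF.memLp_prod_Ioc t)
  simp only [← intervalIntegral.integral_of_le ht.1] at h1 h2
  have hvol : (volume.restrict (Ioc 0 t)).real univ = t := by simp [Measure.real, ht.1]
  rw [hvol, intervalIntegral.integral_of_le ht.1] at h2
  have hi := (memLp_two_iff_integrable_sq_norm hV₀.1).1 hV₀
  have hΦi := (memLp_two_iff_integrable_sq_norm h1.1).1 h1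
  have hs := (memLp_two_iff_integrable_sq_norm (hV₀.add h1).1).1 (hV₀.add h1)
  have h3 : ∫ ω, ‖V₀ ω + ∫ s in (0 : ℝ)..t, F s ω‖ ^ 2 ∂P
      ≤ ∫ ω, (2 * ‖V₀ ω‖ ^ 2 + 2 * ‖∫ s in (0 : ℝ)..t, F s ω‖ ^ 2) ∂P := by
    refine integral_mono hs ((hi.const_mul 2).add (hΦi.const_mul 2)) fun ω => ?_
    have := sq_norm_sub_le (V₀ ω) (-∫ s in (0 : ℝ)..t, F s ω)
    rwa [sub_neg_eq_add, norm_neg] at this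
  rw [integral_add (hi.const_mul 2) (hΦi.const_mul 2), integral_const_mul,
    integral_const_mul] at h3
  refine h3.trans ?_
  gcongr
  refine h2.trans (mul_le_mul ht.2 ?_ (integral_nonneg fun _ => integral_nonneg fun _ => by positivity)
    (ht.1.trans ht.2))
  have hsq : Integrable (fun p : ℝ × Ω => ‖F p.1 p.2‖ ^ 2) ((volume.restrict (Icc 0 T)).prod P) :=
    (memLp_two_iff_integrable_sq_norm (hF.memLp_prod T).1).1 (hF.memLp_prod T)
  have hf : IntegrableOn (fun t => ∫ ω, ‖F t ω‖ ^ 2 ∂P) (Icc 0 T) := hsq.integral_prod_left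
  exact setIntegral_mono_set hf
    (Eventually.of_forall fun _ => integral_nonneg fun _ => by positivity)
    (Eventually.of_forall (Ioc_subset_Icc_self.trans (Icc_subset_Icc_right ht.2)))

lemma IsStrongSolution.isSquareIntegrableProcess [IsFiniteMeasure P]
    (hV : IsStrongSolution P γ V₀ F V)
    (hγ : ∀ i j, IntegrableOn (fun t => γ t i j) (Ioi 0))
    (hF : IsSquareIntegrableProcess P F) (hV₀ : MemLp V₀ 2 P) :
    IsSquareIntegrableProcess P V := by
  have key : ∀ T, ∃ K', ∀ t ∈ Icc 0 T, MemLp (V t) 2 P ∧ ∫ ω, ‖V t ω‖ ^ 2 ∂P ≤ K' := fun T => by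
    obtain ⟨K, hK⟩ := hF.exists_integral_sq_norm_le hV₀ T
    exact memLp_two_of_volterra (continuous_integral_kernelCLM hγ)
      (norm_integral_kernelCLM_le hγ) (hV.measurable.mono T)
      (hV.integrable.mono fun ω h => h T) (fun t ht => hV₀.add (hF.memLp_integral ht.1)) hK
      fun t ht => hV.volterra_equation hγ ht.1
  refine ⟨fun t ht => ?_, fun T => ?_⟩
  · obtain ⟨K', hK'⟩ := key t
    exact (hK' t ⟨ht, le_rfl⟩).1
  · obtain ⟨K', hK'⟩ := key T
    exact memLp_two_prod (hV.measurable.mono T)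
      (ae_restrict_of_forall_mem measurableSet_Icc fun t ht => (hK' t ht).1)
      (ae_restrict_of_forall_mem measurableSet_Icc fun t ht => (hK' t ht).2)

lemma IsStrongSolution.isVolterraProcess [IsFiniteMeasure P]
    (hV : IsStrongSolution P γ V₀ F V)
    (hγ : ∀ i j, IntegrableOn (fun t => γ t i j) (Ioi 0))
    (hF : IsSquareIntegrableProcess P F) (hV₀ : MemLp V₀ 2 P)
    (hunc : ∀ t, 0 ≤ t → crossMoment P (F t) V₀ = 0) :
    IsVolterraProcess P (fun x => ∫ t in (0 : ℝ)..x, kernelCLM γ t) (∫ t, ‖kernelCLM γ t‖)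
      V₀ F V where
  continuous := continuous_integral_kernelCLM hγ
  bound := norm_integral_kernelCLM_le hγ
  eq_zero _ hx := integral_kernelCLM_of_nonpos hx
  init := hV₀
  noise := hF
  solution := hV.isSquareIntegrableProcess hγ hF hV₀
  uncorrelated t ht := by
    rw [secondMoment_eq_toEuclideanCLM (hF.memLp t ht) hV₀, hunc t ht, map_zero]
  equation _ ht := hV.volterra_equation hγ ht

/-- Equality of the primitives of `C_F` and `γ S` amounts to almost everywhere equality. -/
lemma integral_autoCorr_eq_iff (hγ : ∀ i j, IntegrableOn (fun t => γ t i j) (Ioi 0))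
    (hF : IsStationary P F) {c : ℝ → EuclideanSpace ℝ (Fin d) →L[ℝ] EuclideanSpace ℝ (Fin d)}
    (hc : Continuous c) (hcF : ∀ t, 0 ≤ t → c t = secondMoment P (F t) (F 0))
    (S : Matrix (Fin d) (Fin d) ℝ) :
    (∀ x, 0 ≤ x → ∫ u in (0 : ℝ)..x, c u = (∫ t in (0 : ℝ)..x, kernelCLM γ t)
      * Matrix.toEuclideanCLM (n := Fin d) (𝕜 := ℝ) S) ↔
      ∀ᵐ t ∂(volume.restrict (Ici (0 : ℝ))), autoCorr P F t = γ t * S := by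
  set S' := Matrix.toEuclideanCLM (n := Fin d) (𝕜 := ℝ) S
  have hk : ∀ x, IntervalIntegrable (kernelCLM γ) volume 0 x := fun x =>
    (integrable_kernelCLM hγ).intervalIntegrable
  have hkS : ∀ x, IntervalIntegrable (fun t => kernelCLM γ t * S') volume 0 x := fun x =>
    (hk x).mul_continuousOn continuousOn_const
  have hcI : ∀ x, IntervalIntegrable c volume 0 x := fun x => hc.intervalIntegrable _ _
  have hint : ∀ x, ∫ t in (0 : ℝ)..x, (c t - kernelCLM γ t * S')
      = (∫ t in (0 : ℝ)..x, c t) - (∫ t in (0 : ℝ)..x, kernelCLM γ t) * S' := fun x => by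
    rw [intervalIntegral.integral_sub (hcI x) (hkS x), interval_mul_const _ (hk x)]
  -- The time 0 is excluded because `kernelCLM` vanishes there; it is a null set.
  have hpt : ∀ t, 0 < t → (c t - kernelCLM γ t * S' = 0 ↔ autoCorr P F t = γ t * S) := by
    intro t ht
    rw [hcF t ht.le, kernelCLM_of_pos ht, ← map_mul,
      secondMoment_eq_toEuclideanCLM (hF.memLp t ht.le) (hF.memLp 0 le_rfl), sub_eq_zero,
      toEuclideanCLM_inj]
    rfl
  have hne : ∀ᵐ t : ℝ, t ≠ 0 := by simp [ae_iff]
  constructor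
  · intro h
    have h1 := ae_eq_zero_of_integral_eq_zero (f := fun t => c t - kernelCLM γ t * S')
      (fun T _ => (hcI T).sub (hkS T)) fun x hx => by rw [hint, h x hx, sub_self]
    rw [ae_restrict_iff' measurableSet_Ici] at h1 ⊢
    filter_upwards [h1, hne] with t h2 h3 h4
    exact (hpt t (lt_of_le_of_ne h4 h3.symm)).1 (h2 h4)
  · intro h x hx
    rw [← sub_eq_zero, ← hint]
    refine intervalIntegral.integral_zero_ae ?_
    rw [ae_restrict_iff' measurableSet_Ici] at h
    filter_upwards [h] with t h1 h2
    rw [uIoc_of_le hx] at h2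
    exact (hpt t h2.1).2 (h1 h2.1.le)

/-- Second order stationarity in terms of operator valued second moments. -/
lemma isStationary_iff {X : ℝ → Ω → EuclideanSpace ℝ (Fin d)}
    (hX : ∀ t, 0 ≤ t → MemLp (X t) 2 P) (h0 : ∀ t, 0 ≤ t → ∫ ω, X t ω ∂P = 0) :
    IsStationary P X ↔ ∀ s t, 0 ≤ s → 0 ≤ t →
      secondMoment P (X (s + t)) (X s) = secondMoment P (X t) (X 0) := by
  have key : ∀ s t, 0 ≤ s → 0 ≤ t →
      (secondMoment P (X (s + t)) (X s) = secondMoment P (X t) (X 0) ↔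
        crossMoment P (X (s + t)) (X s) = crossMoment P (X t) (X 0)) := fun s t hs ht => by
    rw [secondMoment_eq_toEuclideanCLM (hX _ (add_nonneg hs ht)) (hX s hs),
      secondMoment_eq_toEuclideanCLM (hX t ht) (hX 0 le_rfl),
      toEuclideanCLM_inj]
  exact ⟨fun h s t hs ht => (key s t hs ht).2 (h.shift s t hs ht),
    fun h => ⟨hX, h0, fun s t hs ht => (key s t hs ht).1 (h s t hs ht)⟩⟩

/-- The definition of stationarity covers nonnegative lags only; negative ones follow by taking
adjoints. -/
lemma IsStationary.secondMoment_eq_hermitianExtension (hF : IsStationary P F) (s t : ℝ)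
    (hs : 0 ≤ s) (ht : 0 ≤ t) :
    secondMoment P (F t) (F s)
      = hermitianExtension (fun t => secondMoment P (F t) (F 0)) (t - s) := by
  have h := (isStationary_iff hF.memLp hF.centered).1 hF
  have key : ∀ s t, 0 ≤ s → s ≤ t → secondMoment P (F t) (F s)
      = hermitianExtension (fun t => secondMoment P (F t) (F 0)) (t - s) := fun s t hs hst => by
    have := h s (t - s) hs (by linarith)
    rw [add_sub_cancel] at this
    rw [this, hermitianExtension_of_nonneg (by linarith)]
  rcases le_total s t with hst | hst
  · exact key s t hs hst
  · rw [← star_secondMoment, key t s ht hst, star_hermitianExtension (star_secondMoment _ _),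
      neg_sub]

end Main

end KuboGLE

theorem corollary1 {Ω : Type*} [MeasurableSpace Ω] (P : Measure Ω) [IsProbabilityMeasure P]
    {d : ℕ} (γ : ℝ → Matrix (Fin d) (Fin d) ℝ)
    (hγ : ∀ i j, IntegrableOn (fun t => γ t i j) (Ioi 0))
    (S : Matrix (Fin d) (Fin d) ℝ) (hS : S.PosSemidef)
    (V₀ : Ω → EuclideanSpace ℝ (Fin d)) (hV₀ : HasLaw V₀ (multivariateGaussian 0 S) P)
    (F : ℝ → Ω → EuclideanSpace ℝ (Fin d))
    (hF_meas : KuboGLE.IsMeasurableProcess P F)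
    (hF_gauss : IsGaussianProcess (fun t : Ici (0 : ℝ) => F t) P)
    (hF_stat : KuboGLE.IsStationary P F)
    (hF_cont : KuboGLE.IsMeanSquareContinuous P F)
    (hF_indep : IndepFun V₀ (fun ω (t : Ici (0 : ℝ)) => F t ω) P)
    (V : ℝ → Ω → EuclideanSpace ℝ (Fin d))
    (hV : KuboGLE.IsStrongSolution P γ V₀ F V) :
    (KuboGLE.IsStationary P V ↔
      ∀ᵐ t ∂(volume.restrict (Ici (0 : ℝ))), KuboGLE.autoCorr P F t = γ t * S) ∧
    (KuboGLE.IsStationary P V →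
      ∀ r : ℝ → Matrix (Fin d) (Fin d) ℝ, KuboGLE.IsDifferentialResolvent γ r →
        ∀ t, 0 ≤ t → KuboGLE.autoCorr P V t = r t * S) := by
  have hV₀2 := KuboGLE.memLp_of_hasLaw_gaussian hV₀
  have hF := hF_stat.isSquareIntegrableProcess hF_meas
  have hunc : ∀ t, 0 ≤ t → KuboGLE.crossMoment P (F t) V₀ = 0 := fun t ht =>
    KuboGLE.crossMoment_eq_zero_of_indepFun (t := (⟨t, ht⟩ : Ici (0 : ℝ)))
      (F := fun (t : Ici (0 : ℝ)) ω => F t ω) hF_indep hV₀2.1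
      (KuboGLE.integral_apply_of_hasLaw_gaussian hV₀) (hF_stat.memLp t ht).1
  have h := hV.isVolterraProcess hγ hF hV₀2 hunc
  have hSV : KuboGLE.secondMoment P V₀ V₀ = Matrix.toEuclideanCLM (n := Fin d) (𝕜 := ℝ) S := by
    rw [KuboGLE.secondMoment_eq_toEuclideanCLM hV₀2 hV₀2,
      KuboGLE.crossMoment_of_hasLaw_gaussian hS hV₀]
  constructor
  · have hc0 : star (KuboGLE.secondMoment P (F 0) (F 0)) = KuboGLE.secondMoment P (F 0) (F 0) :=
      KuboGLE.star_secondMoment _ _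
    have hc : Continuous
        (KuboGLE.hermitianExtension fun t => KuboGLE.secondMoment P (F t) (F 0)) :=
      KuboGLE.continuous_hermitianExtension
        (hF_cont.continuousOn_secondMoment hF_stat.memLp (hF_stat.memLp 0 le_rfl)) hc0
    have h1 := h.stationary_iff hc
      (KuboGLE.star_hermitianExtension (f := fun t => KuboGLE.secondMoment P (F t) (F 0)) hc0)
      hF_stat.secondMoment_eq_hermitianExtension
    rw [hSV] at h1
    -- Every strong solution here is square integrable and centred, so only shift invariance of the
    -- second moments remains to be characterized.
    rw [KuboGLE.isStationary_iff h.solution.memLp fun t ht =>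
      h.integral_eq_zero (KuboGLE.integral_of_hasLaw_gaussian hV₀) hF_stat.centered ht, h1]
    exact KuboGLE.integral_autoCorr_eq_iff hγ hF_stat hc
      (fun t ht => KuboGLE.hermitianExtension_of_nonneg ht) S
  · intro _ r hr t ht
    have h1 : KuboGLE.secondMoment P (V t) V₀
        = Matrix.toEuclideanCLM (n := Fin d) (𝕜 := ℝ) (r t)
          * Matrix.toEuclideanCLM (n := Fin d) (𝕜 := ℝ) S := by
      have hcr := hr.continuousOn_toEuclideanCLM
      have hcS : ContinuousOn (fun t => Matrix.toEuclideanCLM (n := Fin d) (𝕜 := ℝ) (r t)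
          * Matrix.toEuclideanCLM (n := Fin d) (𝕜 := ℝ) S) (Ici 0) :=
        hcr.mul continuousOn_const
      -- Multiplying the integrated resolvent equation by `S` on the right gives the Volterra
      -- equation of `secondMoment_init`.
      refine KuboGLE.volterra_unique (T := t)
        (q := fun t => Matrix.toEuclideanCLM (n := Fin d) (𝕜 := ℝ) (r t)
          * Matrix.toEuclideanCLM (n := Fin d) (𝕜 := ℝ) S)
        h.continuous h.bound
        (h.solution.integrableOn_secondMoment t hV₀2)
        (hcS.mono fun x hx => hx.1).integrableOn_Icc (fun u hu => ?_) t ⟨ht, le_rfl⟩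
      rw [h.secondMoment_init hu.1, hSV]
      simp only [← mul_assoc]
      rw [KuboGLE.interval_mul_const, ← add_mul, hr.volterra_equation hγ hu.1, one_mul]
      refine ContinuousOn.intervalIntegrable ?_
      rw [uIcc_of_le hu.1]
      exact ((h.continuous.comp (continuous_const.sub continuous_id)).continuousOn).mul
        (hcr.mono fun x hx => hx.1)
    rw [← KuboGLE.secondMoment_congr (ae_eq_refl _) h.ae_eq_init,
      KuboGLE.secondMoment_eq_toEuclideanCLM (h.solution.memLp t ht)
        (h.solution.memLp 0 le_rfl), ← map_mul] at h1
    exact KuboGLE.toEuclideanCLM_inj.1 h1
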